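/- Let $S$ be an inverse semigroup with zero, ordered by its natural partial order. **Notation.** A *proper filter* of an inverse semigroup with zero is a nonempty, upward closed, downward directed subset not containing $0$. For proper filters put $\mathbf d(A)=(A^{-1}A)^{\uparrow}$, $\mathbf r(A)=(AA^{-1})^{\uparrow}$ and $A\cdot B=(AB)^{\uparrow}$, defined exactly when $\mathbf d(A)=\mathbf r(B)$; this makes the set $\mathcal L(S)$ of proper filters a groupoid. *Paterson's universal groupoid* $\mathsf G_u(S)$ is $\mathcal L(S)$ with the topology having as a basis the sets $$U_{a;a_1,\dots,a_m}=\{A\in\mathcal L(S): a\in A,\ a_1,\dots,a_m\notin A\}\qquad (m\ge 0,\ a_1,\dots,a_m\le a).$$ For a groupoid $G$, a *partial bisection* is a subset on which $\mathbf d$ and $\mathbf r$ are both injective; the partial bisections form an inverse semigroup $\mathsf L(G)$ under multiplication of subsets. If $G$ carries a topology, $\mathsf{KB}(G)$ is the set of compact-open partial bisections. Let $\mathsf D(S)$ be the distributive completion of $S$: the set of order ideals $\{a_1,\dots,a_m\}^{\downarrow}$ generated by nonempty finite compatible subsets of $S$, under multiplication of subsets. It is a distributive inverse semigroup. For a distributive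 inverse semigroup $T$ let $\mathsf G(T)$ be the groupoid of prime filters of $T$ (proper filters $P$ such that $a\vee b\in P$ implies $a\in P$ or $b\in P$), with the operations above; for $t\le s$ put $V_{s;t}=\{P\in\mathsf G(T): s\in P,\ t\notin P\}$. The patch-topology groupoid $\mathsf G(T)^{\dagger}$ is $\mathsf G(T)$ with the topology having the sets $V_{s;t}$ as a basis. The *Booleanization* $\mathsf B(S)$ is the inverse subsemigroup of $\mathsf L(\mathsf G(\mathsf D(S)))$ consisting of the unions of finite compatible sets of partial bisections $V_{s;t}$ ($s,t\in\mathsf D(S)$, $t\le s$), and $\beta\colon S\to\mathsf B(S)$ is $\beta(s)=\{P: s^{\downarrow}\in P\}$. **Theorem.** 1. $\mathsf G_u(S)$ is a Boolean groupoid, i.e. an étale topological groupoid whose space of identities is Hausdorff, locally compact and zero-dimensional. 2. The map $\Phi(F)=\{A\in\mathsf D(S): A\cap F\neq\varnothing\}$ is an isomorphism of groupoids and a homeomorphism from $\mathsf G_u(S)$ onto $\mathsf G(\mathsf D(S))^{\dagger}$. 3. $\mathsf{KB}(\mathsf G_u(S))$ is an inverse subsemigroup of $\mathsf L(\mathsf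 G_u(S))$ and is a Boolean inverse semigroup (a distributive inverse semigroup whose idempotents form a generalized Boolean algebra), and $\mathsf B(S)\cong\mathsf{KB}(\mathsf G_u(S))$. Moreover, $X\mapsto\Phi^{-1}(X)$ is such an isomorphism; it maps $\beta(s)$ to $U_s=\{F\in\mathcal L(S): s\in F\}$ for every $s\in S$. -/

import Mathlib

namespace InvSgp

/-! ### Inverse semigroups with zero -/

/-- An inverse semigroup with zero: every element `a` has exactly one inverse `a⁻¹`. -/
class InverseSemigroupWithZero (S : Type*) extends SemigroupWithZero S, Inv S where
  mul_inv_mul : ∀ a : S, a * a⁻¹ * a = a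
  inv_mul_inv : ∀ a : S, a⁻¹ * a * a⁻¹ = a⁻¹
  inv_unique : ∀ a b : S, a * b * a = a → b * a * b = b → b = a⁻¹

open InverseSemigroupWithZero

section Basics

variable {S : Type*} [InverseSemigroupWithZero S]

theorem inv_inv' (a : S) : a⁻¹⁻¹ = a :=
  (inv_unique a⁻¹ a (inv_mul_inv a) (mul_inv_mul a)).symm

theorem mul_inv_mul' (a : S) : a * (a⁻¹ * a) = a := by
  rw [← mul_assoc, mul_inv_mul]

theorem inv_mul_inv' (a : S) : a⁻¹ * (a * a⁻¹) = a⁻¹ := by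
  rw [← mul_assoc, inv_mul_inv]

theorem inv_idem {e : S} (he : IsIdempotentElem e) : e⁻¹ = e :=
  (inv_unique e e (by rw [he.eq, he.eq]) (by rw [he.eq, he.eq])).symm

theorem idem_inv_mul (a : S) : IsIdempotentElem (a⁻¹ * a) := by
  change _ * _ = _
  rw [mul_assoc, mul_inv_mul']

theorem idem_mul_inv (a : S) : IsIdempotentElem (a * a⁻¹) := by
  change _ * _ = _
  rw [mul_assoc, inv_mul_inv']

theorem idem_mul {e f : S} (he : IsIdempotentElem e) (hf : IsIdempotentElem f) :
    IsIdempotentElem (e * f) := by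
  have e2 : ∀ x : S, e * (e * x) = e * x := fun x => by rw [← mul_assoc, he.eq]
  have f2 : ∀ x : S, f * (f * x) = f * x := fun x => by rw [← mul_assoc, hf.eq]
  set x := (e * f)⁻¹ with hx
  have h1 : e * (f * (x * (e * f))) = e * f := by
    have := mul_inv_mul (e * f); simpa only [mul_assoc] using this
  have h2 : x * (e * (f * x)) = x := by
    have := inv_mul_inv (e * f); simpa only [mul_assoc] using this
  have h3 : f * (x * e) = x := by
    apply inv_unique (e * f)
    · simp only [mul_assoc, e2, f2, h1]
    · have : x * (e * (f * (x * e))) = x * e := by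
        calc x * (e * (f * (x * e))) = (x * (e * (f * x))) * e := by simp only [mul_assoc]
          _ = x * e := by rw [h2]
      simp only [mul_assoc, e2, f2, this]
  have h4 : x * x = x := by
    calc x * x = (f * (x * e)) * (f * (x * e)) := by rw [h3]
      _ = f * ((x * (e * (f * x))) * e) := by simp only [mul_assoc]
      _ = x := by rw [h2, h3]
  have h5 : e * f = x⁻¹ := (inv_inv' (e * f)).symm
  rw [h5, inv_idem h4]
  exact h4

theorem idem_comm {e f : S} (he : IsIdempotentElem e) (hf : IsIdempotentElem f) :
    e * f = f * e := by
  have e2 : ∀ x : S, e * (e * x) = e * x := fun x => by rw [← mul_assoc, he.eq]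
  have f2 : ∀ x : S, f * (f * x) = f * x := fun x => by rw [← mul_assoc, hf.eq]
  have h1 := idem_mul he hf
  have h2 := idem_mul hf he
  have h1e : e * (f * (e * f)) = e * f := by simpa only [mul_assoc] using h1.eq
  have h2e : f * (e * (f * e)) = f * e := by simpa only [mul_assoc] using h2.eq
  have h3 : f * e = (e * f)⁻¹ := by
    apply InverseSemigroupWithZero.inv_unique
    · simp only [mul_assoc, e2, f2, h1e]
    · simp only [mul_assoc, e2, f2, h2e]
  rw [h3, inv_idem h1]

theorem mul_inv_rev' (a b : S) : (a * b)⁻¹ = b⁻¹ * a⁻¹ := by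
  have hc : (a⁻¹ * a) * (b * b⁻¹) = (b * b⁻¹) * (a⁻¹ * a) :=
    idem_comm (idem_inv_mul a) (idem_mul_inv b)
  refine (inv_unique (a * b) _ ?_ ?_).symm
  · calc a * b * (b⁻¹ * a⁻¹) * (a * b) = a * ((b * b⁻¹) * (a⁻¹ * a)) * b := by
          simp only [mul_assoc]
      _ = (a * a⁻¹ * a) * (b * b⁻¹ * b) := by rw [← hc]; simp only [mul_assoc]
      _ = a * b := by rw [mul_inv_mul, mul_inv_mul]
  · calc b⁻¹ * a⁻¹ * (a * b) * (b⁻¹ * a⁻¹) = b⁻¹ * ((a⁻¹ * a) * (b * b⁻¹)) * a⁻¹ := by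
          simp only [mul_assoc]
      _ = (b⁻¹ * b * b⁻¹) * (a⁻¹ * a * a⁻¹) := by rw [hc]; simp only [mul_assoc]
      _ = b⁻¹ * a⁻¹ := by rw [inv_mul_inv, inv_mul_inv]

theorem inv_zero' : (0 : S)⁻¹ = 0 :=
  inv_idem (mul_zero 0)

theorem idem_conj (a : S) {e : S} (he : IsIdempotentElem e) :
    IsIdempotentElem (a * e * a⁻¹) := by
  change _ * _ = _
  have hc := idem_comm he (idem_inv_mul a)
  calc a * e * a⁻¹ * (a * e * a⁻¹) = a * (e * (a⁻¹ * a)) * (e * a⁻¹) := by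
        simp only [mul_assoc]
    _ = (a * a⁻¹ * a) * (e * e) * a⁻¹ := by rw [hc]; simp only [mul_assoc]
    _ = a * e * a⁻¹ := by rw [mul_inv_mul, he.eq]

theorem mul_idem_eq (a : S) {e : S} (he : IsIdempotentElem e) :
    a * e = (a * e * a⁻¹) * a := by
  have hc := idem_comm he (idem_inv_mul a)
  calc a * e = (a * a⁻¹ * a) * e := by rw [mul_inv_mul]
    _ = a * ((a⁻¹ * a) * e) := by simp only [mul_assoc]
    _ = _ := by rw [← hc]; simp only [mul_assoc]

theorem idem_mul_eq (a : S) {e : S} (he : IsIdempotentElem e) :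
    e * a = a * (a⁻¹ * e * a) := by
  have hc := idem_comm he (idem_mul_inv a)
  calc e * a = e * (a * a⁻¹ * a) := by rw [mul_inv_mul]
    _ = (e * (a * a⁻¹)) * a := by simp only [mul_assoc]
    _ = _ := by rw [hc]; simp only [mul_assoc]

theorem idem_conj' (a : S) {e : S} (he : IsIdempotentElem e) :
    IsIdempotentElem (a⁻¹ * e * a) := by
  have := idem_conj a⁻¹ he
  rwa [inv_inv'] at this

/-- The natural partial order of an inverse semigroup. -/
instance naturalOrder : PartialOrder S where
  le a b := ∃ e : S, IsIdempotentElem e ∧ a = b * e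
  le_refl a := ⟨a⁻¹ * a, idem_inv_mul a, (mul_inv_mul' a).symm⟩
  le_trans := by
    rintro a b c ⟨e, he, rfl⟩ ⟨f, hf, rfl⟩
    exact ⟨f * e, idem_mul hf he, mul_assoc _ _ _⟩
  le_antisymm := by
    rintro a b ⟨e, he, rfl⟩ ⟨f, hf, h⟩
    calc b * e = (b * e * f) * e := by rw [← h]
      _ = b * (e * f) * e := by simp only [mul_assoc]
      _ = b * (f * e) * e := by rw [idem_comm he hf]
      _ = b * (f * (e * e)) := by simp only [mul_assoc]
      _ = b * (e * f) := by rw [he.eq, idem_comm he hf]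
      _ = b := by rw [← mul_assoc, ← h]

theorem le_def {a b : S} : a ≤ b ↔ ∃ e : S, IsIdempotentElem e ∧ a = b * e := Iff.rfl

theorem mul_idem_le (a : S) {e : S} (he : IsIdempotentElem e) : a * e ≤ a := ⟨e, he, rfl⟩

theorem idem_mul_le (a : S) {e : S} (he : IsIdempotentElem e) : e * a ≤ a :=
  ⟨a⁻¹ * e * a, idem_conj' a he, idem_mul_eq a he⟩

theorem le_iff_left {a b : S} : a ≤ b ↔ ∃ e : S, IsIdempotentElem e ∧ a = e * b := by
  constructor
  · rintro ⟨e, he, rfl⟩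
    exact ⟨_, idem_conj b he, mul_idem_eq b he⟩
  · rintro ⟨e, he, rfl⟩
    exact idem_mul_le b he

theorem eq_mul_of_le {a b : S} (h : a ≤ b) : b * (a⁻¹ * a) = a := by
  obtain ⟨e, he, rfl⟩ := h
  have hc := idem_comm he (idem_inv_mul b)
  calc b * ((b * e)⁻¹ * (b * e)) = b * (e * (b⁻¹ * b)) * e := by
        rw [mul_inv_rev', inv_idem he]; simp only [mul_assoc]
    _ = (b * b⁻¹ * b) * (e * e) := by rw [hc]; simp only [mul_assoc]
    _ = b * e := by rw [mul_inv_mul, he.eq]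

theorem inv_le_inv' {a b : S} (h : a ≤ b) : a⁻¹ ≤ b⁻¹ := by
  obtain ⟨e, he, rfl⟩ := h
  rw [mul_inv_rev', inv_idem he]
  exact idem_mul_le _ he

theorem eq_mul_of_le' {a b : S} (h : a ≤ b) : a * a⁻¹ * b = a := by
  have := congrArg (fun x : S => x⁻¹) (eq_mul_of_le (inv_le_inv' h))
  simpa only [mul_inv_rev', inv_inv'] using this

theorem mul_le_mul_nat {a b c d : S} (h : a ≤ b) (h' : c ≤ d) : a * c ≤ b * d := by
  obtain ⟨e, he, rfl⟩ := h
  obtain ⟨f, hf, rfl⟩ := h'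
  rw [mul_assoc]
  have h1 : e * (d * f) ≤ d :=
    (idem_mul_le _ he).trans (mul_idem_le d hf)
  obtain ⟨g, hg, h2⟩ := h1
  rw [h2, ← mul_assoc]
  exact mul_idem_le _ hg

theorem zero_le' (a : S) : 0 ≤ a := ⟨0, mul_zero 0, (mul_zero a).symm⟩

theorem eq_zero_of_le {a : S} (h : a ≤ 0) : a = 0 := by
  obtain ⟨e, _, rfl⟩ := h
  exact zero_mul e

theorem idem_of_le {a e : S} (he : IsIdempotentElem e) (h : a ≤ e) : IsIdempotentElem a := by
  obtain ⟨f, hf, rfl⟩ := h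
  exact idem_mul he hf

theorem inv_le_iff {a b : S} : a⁻¹ ≤ b ↔ a ≤ b⁻¹ := by
  constructor
  · intro h
    have := inv_le_inv' h
    rwa [inv_inv'] at this
  · intro h
    have := inv_le_inv' h
    rwa [inv_inv'] at this

theorem inv_mul_le (a b : S) : a⁻¹ * (a * b) ≤ b := by
  rw [← mul_assoc]
  exact idem_mul_le _ (idem_inv_mul a)

theorem mul_inv_le (a b : S) : a * (a⁻¹ * b) ≤ b := by
  rw [← mul_assoc]
  exact idem_mul_le _ (idem_mul_inv a)

/-- The compatibility relation. -/
def Compatible (s t : S) : Prop := IsIdempotentElem (s⁻¹ * t) ∧ IsIdempotentElem (s * t⁻¹)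

theorem Compatible.symm {s t : S} (h : Compatible s t) : Compatible t s := by
  constructor
  · have := h.1
    rw [← inv_idem this, mul_inv_rev', inv_inv'] at this
    exact this
  · have := h.2
    rw [← inv_idem this, mul_inv_rev', inv_inv'] at this
    exact this

theorem Compatible.inv {s t : S} (h : Compatible s t) : Compatible s⁻¹ t⁻¹ :=
  ⟨by rw [inv_inv']; exact h.2, by rw [inv_inv']; exact h.1⟩

theorem Compatible.mono {s t s' t' : S} (h : Compatible s t) (hs : s' ≤ s) (ht : t' ≤ t) :
    Compatible s' t' :=
  ⟨idem_of_le h.1 (mul_le_mul_nat (inv_le_inv' hs) ht),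
    idem_of_le h.2 (mul_le_mul_nat hs (inv_le_inv' ht))⟩

theorem Compatible.refl (s : S) : Compatible s s := ⟨idem_inv_mul s, idem_mul_inv s⟩

theorem Compatible.mul {s t u v : S} (h : Compatible s t) (h' : Compatible u v) :
    Compatible (s * u) (t * v) := by
  constructor
  · have : (s * u)⁻¹ * (t * v) = u⁻¹ * ((s⁻¹ * t) * v) := by
      rw [mul_inv_rev']; simp only [mul_assoc]
    rw [this]
    exact idem_of_le h'.1 (mul_le_mul_nat le_rfl (idem_mul_le _ h.1))
  · have : (s * u) * (t * v)⁻¹ = s * ((u * v⁻¹) * t⁻¹) := by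
      rw [mul_inv_rev']; simp only [mul_assoc]
    rw [this]
    exact idem_of_le h.2 (mul_le_mul_nat le_rfl (idem_mul_le _ h'.2))

end Basics

/-- A distributive inverse semigroup: compatible pairs have joins and multiplication
distributes over them. -/
class IsDistributive (T : Type*) [InverseSemigroupWithZero T] : Prop where
  exists_join : ∀ a b : T, Compatible a b → ∃ c, IsLUB {a, b} c
  mul_join : ∀ a b c x : T, Compatible a b → IsLUB {a, b} c → IsLUB {x * a, x * b} (x * c)
  join_mul : ∀ a b c x : T, Compatible a b → IsLUB {a, b} c → IsLUB {a * x, b * x} (c * x)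

/-- A Boolean inverse semigroup: a distributive inverse semigroup whose idempotents form, under
the natural partial order, a (generalized) Boolean algebra. -/
def IsBoolean (T : Type*) [InverseSemigroupWithZero T] : Prop :=
  IsDistributive T ∧ ∃ A : GeneralizedBooleanAlgebra {e : T // IsIdempotentElem e},
    ∀ e f : {e : T // IsIdempotentElem e}, A.le e f ↔ (e : T) ≤ (f : T)

/-- An inverse subsemigroup (containing zero). -/
structure InverseSubsemigroup (T : Type*) [InverseSemigroupWithZero T] where
  carrier : Set T
  zero_mem : (0 : T) ∈ carrier
  mul_mem : ∀ {a b : T}, a ∈ carrier → b ∈ carrier → a * b ∈ carrier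
  inv_mem : ∀ {a : T}, a ∈ carrier → a⁻¹ ∈ carrier

instance {T : Type*} [InverseSemigroupWithZero T] : SetLike (InverseSubsemigroup T) T where
  coe K := K.carrier
  coe_injective := by
    rintro ⟨A, _, _, _⟩ ⟨B, _, _, _⟩ h
    congr

instance {T : Type*} [InverseSemigroupWithZero T] (K : InverseSubsemigroup T) :
    InverseSemigroupWithZero K where
  mul a b := ⟨a.1 * b.1, K.mul_mem a.2 b.2⟩
  zero := ⟨0, K.zero_mem⟩
  inv a := ⟨a.1⁻¹, K.inv_mem a.2⟩
  mul_assoc a b c := Subtype.ext (mul_assoc a.1 b.1 c.1)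
  zero_mul a := Subtype.ext (zero_mul a.1)
  mul_zero a := Subtype.ext (mul_zero a.1)
  mul_inv_mul a := Subtype.ext (mul_inv_mul a.1)
  inv_mul_inv a := Subtype.ext (inv_mul_inv a.1)
  inv_unique a b h h' :=
    Subtype.ext (inv_unique a.1 b.1 (congrArg Subtype.val h) (congrArg Subtype.val h'))

/-! ### Groupoids and partial bisections -/

/-- A groupoid, given by its set of arrows `G`; the identities are the arrows `d x`
(equivalently, the arrows `r x`), and the product of `x` and `y` is defined exactly when `d x = r y`. -/
class ArrowGroupoid (G : Type*) where
  d : G → G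
  r : G → G
  inv : G → G
  comp : ∀ x y : G, d x = r y → G
  d_r : ∀ x, d (r x) = r x
  r_d : ∀ x, r (d x) = d x
  d_inv : ∀ x, d (inv x) = r x
  r_inv : ∀ x, r (inv x) = d x
  d_comp : ∀ x y h, d (comp x y h) = d y
  r_comp : ∀ x y h, r (comp x y h) = r x
  comp_d : ∀ x h, comp x (d x) h = x
  r_comp_self : ∀ x h, comp (r x) x h = x
  comp_inv : ∀ x h, comp x (inv x) h = r x
  inv_comp : ∀ x h, comp (inv x) x h = d x
  assoc : ∀ x y z h h' k k', comp (comp x y h) z k = comp x (comp y z h') k'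

namespace ArrowGroupoid

variable {G : Type*} [ArrowGroupoid G]

theorem comp_congr {x x' y y' : G} (hx : x = x') (hy : y = y') (h : d x = r y) :
    comp x y h = comp x' y' (by rw [← hx, ← hy]; exact h) := by
  subst hx; subst hy; rfl

theorem inv_comp_cancel (x y : G) (h : d x = r y) (k) : comp (inv x) (comp x y h) k = y := by
  rw [← assoc (inv x) x y (d_inv x) h (by rw [d_comp, h])]
  rw [comp_congr (inv_comp x (d_inv x)) rfl, comp_congr h rfl, r_comp_self]

theorem comp_inv_cancel (x y : G) (h : d x = r y) (k) : comp (comp x y h) (inv y) k = x := by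
  rw [assoc x y (inv y) h (r_inv y).symm _ (by rw [r_comp, h])]
  rw [comp_congr rfl (comp_inv y (r_inv y).symm), comp_congr rfl h.symm, comp_d]

theorem inv_unique {x y : G} (h : d x = r y) (h' : comp x y h = r x) : y = inv x := by
  have e1 := inv_comp_cancel x y h (by rw [d_inv, r_comp])
  rw [comp_congr rfl h', comp_congr rfl (d_inv x).symm, comp_d] at e1
  exact e1.symm

theorem inv_inv (x : G) : inv (inv x) = x :=
  (inv_unique (d_inv x) (by rw [inv_comp, r_inv])).symm

end ArrowGroupoid

open ArrowGroupoid

/-- A functor between groupoids (preserves identities and products). -/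
def IsFunctor {G H : Type*} [ArrowGroupoid G] [ArrowGroupoid H] (f : G → H) : Prop :=
  (∀ x, f (d x) = d (f x)) ∧ (∀ x, f (r x) = r (f x)) ∧
    ∀ (x y : G) (h : d x = r y), ∃ h' : d (f x) = r (f y), f (comp x y h) = comp (f x) (f y) h'

/-- The set of identities of a groupoid. -/
abbrev Identities (G : Type*) [ArrowGroupoid G] : Type _ := {x : G // d x = x}

/-- A Boolean groupoid: an étale topological groupoid whose space of identities is Hausdorff,
locally compact and zero-dimensional. -/
structure IsBooleanGroupoid (G : Type*) [ArrowGroupoid G] [TopologicalSpace G] : Prop where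
  continuous_inv : Continuous (inv : G → G)
  continuous_comp :
    Continuous (fun p : {p : G × G // d p.1 = r p.2} => comp p.1.1 p.1.2 p.2)
  etale : IsLocalHomeomorph
    (fun x : G => (⟨d x, by rw [← r_d x, d_r]⟩ : Identities G))
  t2 : T2Space (Identities G)
  locallyCompact : LocallyCompactSpace (Identities G)
  zeroDim : TopologicalSpace.IsTopologicalBasis {U : Set (Identities G) | IsClopen U}

/-- A partial bisection of a groupoid: a set of arrows on which `d` and `r` are injective. -/
@[ext]
structure PartialBisection (G : Type*) [ArrowGroupoid G] where
  carrier : Set G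
  d_inj : Set.InjOn d carrier
  r_inj : Set.InjOn r carrier

namespace PartialBisection

variable {G : Type*} [ArrowGroupoid G]

instance : SetLike (PartialBisection G) G where
  coe X := X.carrier
  coe_injective := fun _ _ h => PartialBisection.ext h

/-- The inverse semigroup of partial bisections under multiplication and inversion of subsets. -/
instance : InverseSemigroupWithZero (PartialBisection G) where
  mul X Y :=
    { carrier := {z | ∃ x ∈ X.carrier, ∃ y ∈ Y.carrier, ∃ h : d x = r y, z = comp x y h}
      d_inj := by
        rintro _ ⟨x, hx, y, hy, h, rfl⟩ _ ⟨x', hx', y', hy', h', rfl⟩ e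
        rw [d_comp, d_comp] at e
        have e1 := Y.d_inj hy hy' e
        subst e1
        have e2 := X.d_inj hx hx' (h.trans h'.symm)
        subst e2
        rfl
      r_inj := by
        rintro _ ⟨x, hx, y, hy, h, rfl⟩ _ ⟨x', hx', y', hy', h', rfl⟩ e
        rw [r_comp, r_comp] at e
        have e1 := X.r_inj hx hx' e
        subst e1
        have e2 := Y.r_inj hy hy' (h.symm.trans h')
        subst e2
        rfl }
  zero :=
    { carrier := ∅
      d_inj := Set.injOn_empty _
      r_inj := Set.injOn_empty _ }
  inv X :=
    { carrier := {x | inv x ∈ X.carrier}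
      d_inj := by
        intro x hx y hy e
        have := X.r_inj hx hy (by rw [r_inv, r_inv, e])
        rw [← ArrowGroupoid.inv_inv x, this, ArrowGroupoid.inv_inv]
      r_inj := by
        intro x hx y hy e
        have := X.d_inj hx hy (by rw [d_inv, d_inv, e])
        rw [← ArrowGroupoid.inv_inv x, this, ArrowGroupoid.inv_inv] }
  mul_assoc X Y Z := by
    apply PartialBisection.ext
    ext w
    constructor
    · rintro ⟨_, ⟨x, hx, y, hy, h, rfl⟩, z, hz, k, rfl⟩
      have h' : d y = r z := by rw [← k, d_comp]
      exact ⟨x, hx, comp y z h', ⟨y, hy, z, hz, h', rfl⟩, by rw [r_comp, h], assoc _ _ _ _ _ _ _⟩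
    · rintro ⟨x, hx, _, ⟨y, hy, z, hz, h, rfl⟩, k, rfl⟩
      have h' : d x = r y := by rw [k, r_comp]
      exact ⟨comp x y h', ⟨x, hx, y, hy, h', rfl⟩, z, hz, by rw [d_comp, h],
        (assoc _ _ _ _ _ _ _).symm⟩
  zero_mul X := by
    apply PartialBisection.ext
    ext w
    constructor
    · rintro ⟨x, hx, _⟩
      exact hx
    · intro h
      exact h.elim
  mul_zero X := by
    apply PartialBisection.ext
    ext w
    constructor
    · rintro ⟨x, hx, y, hy, _⟩
      exact hy
    · intro h
      exact h.elim
  mul_inv_mul X := by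
    apply PartialBisection.ext
    ext w
    constructor
    · rintro ⟨_, ⟨x, hx, y, hy, h, rfl⟩, z, hz, k, rfl⟩
      have e1 : x = inv y := X.d_inj hx hy (by rw [d_inv, h])
      have e2 : inv y = z := X.r_inj hy hz (by rw [r_inv, ← k, d_comp])
      subst e1
      subst e2
      rw [comp_congr (inv_comp y (d_inv y)) rfl, comp_congr (r_inv y).symm rfl, r_comp_self]
      exact hx
    · intro hw
      refine ⟨comp w (inv w) (r_inv w).symm, ⟨w, hw, inv w, ?_, _, rfl⟩, w, hw, ?_, ?_⟩
      · change inv (inv w) ∈ X.carrier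
        rwa [ArrowGroupoid.inv_inv]
      · rw [comp_inv, d_r]
      · rw [comp_congr (comp_inv w _) rfl, r_comp_self]
  inv_mul_inv X := by
    apply PartialBisection.ext
    ext w
    constructor
    · rintro ⟨_, ⟨x, hx, y, hy, h, rfl⟩, z, hz, k, rfl⟩
      have e1 : inv x = y := X.r_inj hx hy (by rw [r_inv, h])
      have e2 : y = inv z := X.d_inj hy hz (by rw [d_inv, ← k, d_comp])
      subst e1
      have e3 : x = z := by rw [← ArrowGroupoid.inv_inv x, e2, ArrowGroupoid.inv_inv]
      subst e3
      rw [comp_congr (comp_inv x _) rfl, r_comp_self]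
      exact hx
    · intro hw
      refine ⟨comp w (inv w) (r_inv w).symm, ⟨w, hw, inv w, ?_, _, rfl⟩, w, hw, ?_, ?_⟩
      · exact hw
      · rw [comp_inv, d_r]
      · rw [comp_congr (comp_inv w _) rfl, r_comp_self]
  inv_unique X Y h h' := by
    have key : ∀ X Y : PartialBisection G,
        (∀ y ∈ Y.carrier, ∃ w, (∃ y1 ∈ Y.carrier, ∃ x ∈ X.carrier, ∃ h : d y1 = r x,
            w = comp y1 x h) ∧ ∃ y2 ∈ Y.carrier, ∃ h : d w = r y2, y = comp w y2 h) →
          ∀ y ∈ Y.carrier, inv y ∈ X.carrier := by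
      intro X Y h y hy
      obtain ⟨_, ⟨y1, hy1, x, hx, k1, rfl⟩, y2, hy2, k2, e⟩ := h y hy
      have e1 : y = y1 := Y.r_inj hy hy1 (by rw [e, r_comp, r_comp])
      have e2 : y = y2 := Y.d_inj hy hy2 (by rw [e, d_comp])
      subst e1
      subst e2
      have e3 : comp y x k1 = r y := by
        have c1 := comp_inv_cancel (comp y x k1) y k2 (by rw [r_inv, d_comp])
        rw [comp_congr e.symm rfl, comp_inv] at c1
        exact c1.symm
      rw [← ArrowGroupoid.inv_unique k1 e3]
      exact hx
    have h1 := key X Y (by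
      intro y hy
      have hy' := (Set.ext_iff.1 (congrArg PartialBisection.carrier h') y).2 hy
      obtain ⟨w, hw, y2, hy2, k, e⟩ := hy'
      exact ⟨w, hw, y2, hy2, k, e⟩)
    have h2 := key Y X (by
      intro y hy
      have hy' := (Set.ext_iff.1 (congrArg PartialBisection.carrier h) y).2 hy
      obtain ⟨w, hw, y2, hy2, k, e⟩ := hy'
      exact ⟨w, hw, y2, hy2, k, e⟩)
    apply PartialBisection.ext
    ext w
    constructor
    · exact h1 w
    · intro hw
      have := h2 _ hw
      rwa [ArrowGroupoid.inv_inv] at this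

end PartialBisection

/-! ### Filters -/

/-- A proper filter: a nonempty, upward closed, downward directed subset omitting zero. -/
@[ext]
structure ProperFilter (S : Type*) [InverseSemigroupWithZero S] where
  carrier : Set S
  nonempty : carrier.Nonempty
  upper : ∀ {a b : S}, a ∈ carrier → a ≤ b → b ∈ carrier
  directed : ∀ {a b : S}, a ∈ carrier → b ∈ carrier → ∃ c ∈ carrier, c ≤ a ∧ c ≤ b
  zero_notMem : (0 : S) ∉ carrier

namespace ProperFilter

variable {S : Type*} [InverseSemigroupWithZero S]

instance : SetLike (ProperFilter S) S where
  coe A := A.carrier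
  coe_injective := fun _ _ h => ProperFilter.ext h

/-- The filter `A⁻¹`. -/
def invF (A : ProperFilter S) : ProperFilter S where
  carrier := {s | s⁻¹ ∈ A.carrier}
  nonempty := by
    obtain ⟨a, ha⟩ := A.nonempty
    exact ⟨a⁻¹, by change a⁻¹⁻¹ ∈ A.carrier; rwa [inv_inv']⟩
  upper h h' := A.upper h (inv_le_inv' h')
  directed h h' := by
    obtain ⟨c, hc, h1, h2⟩ := A.directed h h'
    refine ⟨c⁻¹, by change c⁻¹⁻¹ ∈ A.carrier; rwa [inv_inv'], inv_le_iff.2 h1, inv_le_iff.2 h2⟩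
  zero_notMem h := A.zero_notMem (by
    have h' : (0 : S)⁻¹ ∈ A.carrier := h
    rwa [inv_zero'] at h')

/-- The filter `d(A) = (A⁻¹A)↑`. -/
def dF (A : ProperFilter S) : ProperFilter S where
  carrier := {s | ∃ a ∈ A.carrier, ∃ b ∈ A.carrier, a⁻¹ * b ≤ s}
  nonempty := by
    obtain ⟨a, ha⟩ := A.nonempty
    exact ⟨_, a, ha, a, ha, le_rfl⟩
  upper := by
    rintro s t ⟨a, ha, b, hb, h⟩ h'
    exact ⟨a, ha, b, hb, h.trans h'⟩
  directed := by
    rintro s t ⟨a, ha, b, hb, h⟩ ⟨a', ha', b', hb', h'⟩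
    obtain ⟨c, hc, h1, h2⟩ := A.directed ha ha'
    obtain ⟨e, he, h3, h4⟩ := A.directed hb hb'
    exact ⟨c⁻¹ * e, ⟨c, hc, e, he, le_rfl⟩,
      (mul_le_mul_nat (inv_le_inv' h1) h3).trans h,
      (mul_le_mul_nat (inv_le_inv' h2) h4).trans h'⟩
  zero_notMem := by
    rintro ⟨a, ha, b, hb, h⟩
    obtain ⟨c, hc, h1, h2⟩ := A.directed ha hb
    have h3 : c⁻¹ * c = 0 := eq_zero_of_le ((mul_le_mul_nat (inv_le_inv' h1) h2).trans h)
    have h4 := mul_inv_mul' c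
    rw [h3, mul_zero] at h4
    exact A.zero_notMem (h4 ▸ hc)

/-- The filter `r(A) = (AA⁻¹)↑`. -/
def rF (A : ProperFilter S) : ProperFilter S where
  carrier := {s | ∃ a ∈ A.carrier, ∃ b ∈ A.carrier, a * b⁻¹ ≤ s}
  nonempty := by
    obtain ⟨a, ha⟩ := A.nonempty
    exact ⟨_, a, ha, a, ha, le_rfl⟩
  upper := by
    rintro s t ⟨a, ha, b, hb, h⟩ h'
    exact ⟨a, ha, b, hb, h.trans h'⟩
  directed := by
    rintro s t ⟨a, ha, b, hb, h⟩ ⟨a', ha', b', hb', h'⟩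
    obtain ⟨c, hc, h1, h2⟩ := A.directed ha ha'
    obtain ⟨e, he, h3, h4⟩ := A.directed hb hb'
    exact ⟨c * e⁻¹, ⟨c, hc, e, he, le_rfl⟩,
      (mul_le_mul_nat h1 (inv_le_inv' h3)).trans h,
      (mul_le_mul_nat h2 (inv_le_inv' h4)).trans h'⟩
  zero_notMem := by
    rintro ⟨a, ha, b, hb, h⟩
    obtain ⟨c, hc, h1, h2⟩ := A.directed ha hb
    have h3 : c * c⁻¹ = 0 := eq_zero_of_le ((mul_le_mul_nat h1 (inv_le_inv' h2)).trans h)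
    have h4 := mul_inv_mul c
    rw [h3, zero_mul] at h4
    exact A.zero_notMem (h4 ▸ hc)

theorem mem_dF {A : ProperFilter S} {s : S} :
    s ∈ A.dF.carrier ↔ ∃ a ∈ A.carrier, a⁻¹ * a ≤ s := by
  constructor
  · rintro ⟨a, ha, b, hb, h⟩
    obtain ⟨c, hc, h1, h2⟩ := A.directed ha hb
    exact ⟨c, hc, (mul_le_mul_nat (inv_le_inv' h1) h2).trans h⟩
  · rintro ⟨a, ha, h⟩
    exact ⟨a, ha, a, ha, h⟩

theorem mem_rF {A : ProperFilter S} {s : S} :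
    s ∈ A.rF.carrier ↔ ∃ a ∈ A.carrier, a * a⁻¹ ≤ s := by
  constructor
  · rintro ⟨a, ha, b, hb, h⟩
    obtain ⟨c, hc, h1, h2⟩ := A.directed ha hb
    exact ⟨c, hc, (mul_le_mul_nat h1 (inv_le_inv' h2)).trans h⟩
  · rintro ⟨a, ha, h⟩
    exact ⟨a, ha, a, ha, h⟩

/-- If `d(A) = r(B)`, elements of `B` may be restricted to domains of elements of `A`. -/
theorem restrict_right {A B : ProperFilter S} (h : A.dF = B.rF) {a b : S} (ha : a ∈ A.carrier)
    (hb : b ∈ B.carrier) : a⁻¹ * (a * b) ∈ B.carrier := by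
  have h1 : a⁻¹ * a ∈ B.rF.carrier := h ▸ (⟨a, ha, a, ha, le_rfl⟩ : a⁻¹ * a ∈ A.dF.carrier)
  obtain ⟨c, hc, h2⟩ := mem_rF.1 h1
  obtain ⟨x, hx, h3, h4⟩ := B.directed hc hb
  refine B.upper hx ?_
  have h5 : x * x⁻¹ ≤ a⁻¹ * a := (mul_le_mul_nat h3 (inv_le_inv' h3)).trans h2
  calc x = (x * x⁻¹) * x := (mul_inv_mul x).symm
    _ ≤ (a⁻¹ * a) * b := mul_le_mul_nat h5 h4
    _ = a⁻¹ * (a * b) := mul_assoc _ _ _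

theorem restrict_left {A B : ProperFilter S} (h : A.dF = B.rF) {a b : S} (ha : a ∈ A.carrier)
    (hb : b ∈ B.carrier) : a * b * b⁻¹ ∈ A.carrier := by
  have h1 : b * b⁻¹ ∈ A.dF.carrier := h ▸ (⟨b, hb, b, hb, le_rfl⟩ : b * b⁻¹ ∈ B.rF.carrier)
  obtain ⟨c, hc, h2⟩ := mem_dF.1 h1
  obtain ⟨x, hx, h3, h4⟩ := A.directed hc ha
  refine A.upper hx ?_
  have h5 : x⁻¹ * x ≤ b * b⁻¹ := (mul_le_mul_nat (inv_le_inv' h3) h3).trans h2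
  calc x = x * (x⁻¹ * x) := (mul_inv_mul' x).symm
    _ ≤ a * (b * b⁻¹) := mul_le_mul_nat h4 h5
    _ = a * b * b⁻¹ := (mul_assoc _ _ _).symm

/-- The product `A · B = (AB)↑`, defined when `d(A) = r(B)`. -/
def compF (A B : ProperFilter S) (h : A.dF = B.rF) : ProperFilter S where
  carrier := {s | ∃ a ∈ A.carrier, ∃ b ∈ B.carrier, a * b ≤ s}
  nonempty := by
    obtain ⟨a, ha⟩ := A.nonempty
    obtain ⟨b, hb⟩ := B.nonempty
    exact ⟨_, a, ha, b, hb, le_rfl⟩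
  upper := by
    rintro s t ⟨a, ha, b, hb, h⟩ h'
    exact ⟨a, ha, b, hb, h.trans h'⟩
  directed := by
    rintro s t ⟨a, ha, b, hb, h⟩ ⟨a', ha', b', hb', h'⟩
    obtain ⟨c, hc, h1, h2⟩ := A.directed ha ha'
    obtain ⟨e, he, h3, h4⟩ := B.directed hb hb'
    exact ⟨c * e, ⟨c, hc, e, he, le_rfl⟩,
      (mul_le_mul_nat h1 h3).trans h, (mul_le_mul_nat h2 h4).trans h'⟩
  zero_notMem := by
    rintro ⟨a, ha, b, hb, h0⟩
    have h1 := restrict_right h ha hb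
    rw [eq_zero_of_le h0, mul_zero] at h1
    exact B.zero_notMem h1

theorem dF_rF (A : ProperFilter S) : A.rF.dF = A.rF := by
  apply ProperFilter.ext
  ext s
  rw [mem_dF, mem_rF]
  constructor
  · rintro ⟨x, hx, h⟩
    obtain ⟨a, ha, h1⟩ := mem_rF.1 hx
    refine ⟨a, ha, le_trans ?_ h⟩
    have h2 := mul_le_mul_nat (inv_le_inv' h1) h1
    rwa [inv_idem (idem_mul_inv a), (idem_mul_inv a).eq] at h2
  · rintro ⟨a, ha, h⟩
    refine ⟨a * a⁻¹, mem_rF.2 ⟨a, ha, le_rfl⟩, ?_⟩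
    rwa [inv_idem (idem_mul_inv a), (idem_mul_inv a).eq]

theorem rF_dF (A : ProperFilter S) : A.dF.rF = A.dF := by
  apply ProperFilter.ext
  ext s
  rw [mem_rF, mem_dF]
  constructor
  · rintro ⟨x, hx, h⟩
    obtain ⟨a, ha, h1⟩ := mem_dF.1 hx
    refine ⟨a, ha, le_trans ?_ h⟩
    have h2 := mul_le_mul_nat h1 (inv_le_inv' h1)
    rwa [inv_idem (idem_inv_mul a), (idem_inv_mul a).eq] at h2
  · rintro ⟨a, ha, h⟩
    refine ⟨a⁻¹ * a, mem_dF.2 ⟨a, ha, le_rfl⟩, ?_⟩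
    rwa [inv_idem (idem_inv_mul a), (idem_inv_mul a).eq]

theorem dF_invF (A : ProperFilter S) : A.invF.dF = A.rF := by
  apply ProperFilter.ext
  ext s
  rw [mem_dF, mem_rF]
  constructor
  · rintro ⟨a, ha, h⟩
    exact ⟨a⁻¹, ha, by rwa [inv_inv']⟩
  · rintro ⟨a, ha, h⟩
    exact ⟨a⁻¹, by change a⁻¹⁻¹ ∈ A.carrier; rwa [inv_inv'], by rwa [inv_inv']⟩

theorem rF_invF (A : ProperFilter S) : A.invF.rF = A.dF := by
  apply ProperFilter.ext
  ext s
  rw [mem_dF, mem_rF]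
  constructor
  · rintro ⟨a, ha, h⟩
    exact ⟨a⁻¹, ha, by rwa [inv_inv']⟩
  · rintro ⟨a, ha, h⟩
    exact ⟨a⁻¹, by change a⁻¹⁻¹ ∈ A.carrier; rwa [inv_inv'], by rwa [inv_inv']⟩

theorem dF_compF (A B : ProperFilter S) (h : A.dF = B.rF) : (A.compF B h).dF = B.dF := by
  apply ProperFilter.ext
  ext s
  rw [mem_dF, mem_dF]
  constructor
  · rintro ⟨x, ⟨a, ha, b, hb, h1⟩, h2⟩
    refine ⟨_, restrict_right h ha hb, le_trans (le_of_eq ?_)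
      ((mul_le_mul_nat (inv_le_inv' h1) h1).trans h2)⟩
    simp only [mul_inv_rev', inv_inv']
    calc b⁻¹ * a⁻¹ * a * (a⁻¹ * (a * b)) = b⁻¹ * (a⁻¹ * (a * a⁻¹ * a)) * b := by
          simp only [mul_assoc]
      _ = _ := by rw [mul_inv_mul]; simp only [mul_assoc]
  · rintro ⟨b, hb, h1⟩
    obtain ⟨a, ha⟩ := A.nonempty
    refine ⟨a * b, ⟨a, ha, b, hb, le_rfl⟩, le_trans ?_ h1⟩
    rw [mul_inv_rev', mul_assoc]
    exact mul_le_mul_nat le_rfl (inv_mul_le a b)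

theorem rF_compF (A B : ProperFilter S) (h : A.dF = B.rF) : (A.compF B h).rF = A.rF := by
  apply ProperFilter.ext
  ext s
  rw [mem_rF, mem_rF]
  constructor
  · rintro ⟨x, ⟨a, ha, b, hb, h1⟩, h2⟩
    refine ⟨_, restrict_left h ha hb, le_trans (le_of_eq ?_)
      ((mul_le_mul_nat h1 (inv_le_inv' h1)).trans h2)⟩
    simp only [mul_inv_rev', inv_inv']
    calc a * b * b⁻¹ * (b * (b⁻¹ * a⁻¹)) = a * (b * b⁻¹ * b) * b⁻¹ * a⁻¹ := by
          simp only [mul_assoc]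
      _ = _ := by rw [mul_inv_mul]; simp only [mul_assoc]
  · rintro ⟨a, ha, h1⟩
    obtain ⟨b, hb⟩ := B.nonempty
    refine ⟨a * b, ⟨a, ha, b, hb, le_rfl⟩, le_trans ?_ h1⟩
    rw [mul_inv_rev', mul_assoc]
    exact mul_le_mul_nat le_rfl (mul_inv_le b _)

/-- The groupoid of proper filters. -/
instance : ArrowGroupoid (ProperFilter S) where
  d := dF
  r := rF
  inv := invF
  comp := compF
  d_r := dF_rF
  r_d := rF_dF
  d_inv := dF_invF
  r_inv := rF_invF
  d_comp := dF_compF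
  r_comp := rF_compF
  comp_d A h := by
    apply ProperFilter.ext
    ext s
    constructor
    · rintro ⟨a, ha, x, hx, h1⟩
      obtain ⟨b, hb, h2⟩ := mem_dF.1 hx
      obtain ⟨c, hc, h3, h4⟩ := A.directed ha hb
      refine A.upper hc (le_trans ?_ h1)
      calc c = c * (c⁻¹ * c) := (mul_inv_mul' c).symm
        _ ≤ a * x := mul_le_mul_nat h3 ((mul_le_mul_nat (inv_le_inv' h4) h4).trans h2)
    · intro hs
      exact ⟨s, hs, s⁻¹ * s, ⟨s, hs, s, hs, le_rfl⟩, (mul_inv_mul' s).le⟩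
  r_comp_self A h := by
    apply ProperFilter.ext
    ext s
    constructor
    · rintro ⟨x, hx, a, ha, h1⟩
      obtain ⟨b, hb, h2⟩ := mem_rF.1 hx
      obtain ⟨c, hc, h3, h4⟩ := A.directed ha hb
      refine A.upper hc (le_trans ?_ h1)
      calc c = (c * c⁻¹) * c := (mul_inv_mul c).symm
        _ ≤ x * a := mul_le_mul_nat ((mul_le_mul_nat h4 (inv_le_inv' h4)).trans h2) h3
    · intro hs
      exact ⟨s * s⁻¹, ⟨s, hs, s, hs, le_rfl⟩, s, hs, (mul_inv_mul s).le⟩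
  comp_inv A h := by
    apply ProperFilter.ext
    ext s
    constructor
    · rintro ⟨a, ha, x, hx, h1⟩
      exact ⟨a, ha, x⁻¹, hx, by rwa [inv_inv']⟩
    · rintro ⟨a, ha, x, hx, h1⟩
      exact ⟨a, ha, x⁻¹, by change x⁻¹⁻¹ ∈ A.carrier; rwa [inv_inv'], h1⟩
  inv_comp A h := by
    apply ProperFilter.ext
    ext s
    constructor
    · rintro ⟨a, ha, x, hx, h1⟩
      exact ⟨a⁻¹, ha, x, hx, by rwa [inv_inv']⟩
    · rintro ⟨a, ha, x, hx, h1⟩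
      exact ⟨a⁻¹, by change a⁻¹⁻¹ ∈ A.carrier; rwa [inv_inv'], x, hx, h1⟩
  assoc A B C h h' k k' := by
    apply ProperFilter.ext
    ext s
    constructor
    · rintro ⟨x, ⟨a, ha, b, hb, h1⟩, c, hc, h2⟩
      refine ⟨a, ha, b * c, ⟨b, hb, c, hc, le_rfl⟩, le_trans ?_ h2⟩
      rw [← mul_assoc]
      exact mul_le_mul_nat h1 le_rfl
    · rintro ⟨a, ha, x, ⟨b, hb, c, hc, h1⟩, h2⟩
      refine ⟨a * b, ⟨a, ha, b, hb, le_rfl⟩, c, hc, le_trans ?_ h2⟩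
      rw [mul_assoc]
      exact mul_le_mul_nat le_rfl h1

/-- If `d` agrees on two filters with a common element, they are equal. -/
theorem eq_of_dF_eq {A B : ProperFilter S} {s : S} (hA : s ∈ A.carrier) (hB : s ∈ B.carrier)
    (h : A.dF = B.dF) : A = B := by
  have key : ∀ A B : ProperFilter S, s ∈ A.carrier → s ∈ B.carrier → A.dF = B.dF →
      ∀ x ∈ A.carrier, x ∈ B.carrier := by
    intro A B hA hB h x hx
    obtain ⟨c, hc, h1, h2⟩ := A.directed hx hA
    have h3 : c⁻¹ * c ∈ B.dF.carrier := h ▸ (⟨c, hc, c, hc, le_rfl⟩ : c⁻¹ * c ∈ A.dF.carrier)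
    obtain ⟨b, hb, h4⟩ := mem_dF.1 h3
    obtain ⟨e, he, h5, h6⟩ := B.directed hb hB
    refine B.upper he ?_
    calc e = e * (e⁻¹ * e) := (mul_inv_mul' e).symm
      _ ≤ s * (c⁻¹ * c) :=
        mul_le_mul_nat h6 ((mul_le_mul_nat (inv_le_inv' h5) h5).trans h4)
      _ = c := eq_mul_of_le h2
      _ ≤ x := h1
  apply ProperFilter.ext
  ext x
  exact ⟨key A B hA hB h x, key B A hB hA h.symm x⟩

theorem invF_invF (A : ProperFilter S) : A.invF.invF = A := ArrowGroupoid.inv_inv A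

theorem eq_of_rF_eq {A B : ProperFilter S} {s : S} (hA : s ∈ A.carrier) (hB : s ∈ B.carrier)
    (h : A.rF = B.rF) : A = B := by
  have h1 : A.invF = B.invF := by
    apply eq_of_dF_eq (s := s⁻¹)
    · change s⁻¹⁻¹ ∈ A.carrier; rwa [inv_inv']
    · change s⁻¹⁻¹ ∈ B.carrier; rwa [inv_inv']
    · rw [dF_invF, dF_invF, h]
  rw [← invF_invF A, h1, invF_invF]

end ProperFilter

/-! ### The universal groupoid -/

/-- The universal groupoid of `S`: the groupoid of proper filters of `S` with the topology having
as a basis the sets `U_{a; a₁, …, aₘ}` where `a₁, …, aₘ ≤ a`. -/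
abbrev UniversalGroupoid (S : Type*) [InverseSemigroupWithZero S] : Type _ := ProperFilter S

/-- `U_{a; a₁, …, aₘ}`: the proper filters that contain `a` and omit every `aᵢ`. -/
def basicU {S : Type*} [InverseSemigroupWithZero S] (a : S) (F : Finset S) :
    Set (UniversalGroupoid S) :=
  {A | a ∈ A ∧ ∀ x ∈ F, x ∉ A}

instance universalTopology {S : Type*} [InverseSemigroupWithZero S] :
    TopologicalSpace (UniversalGroupoid S) :=
  TopologicalSpace.generateFrom
    {X | ∃ (a : S) (F : Finset S), (∀ x ∈ F, x ≤ a) ∧ X = basicU a F}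

/-! ### Prime filters -/

/-- A prime filter: a proper filter `A` such that `a ∨ b ∈ A` implies `a ∈ A` or `b ∈ A`. -/
@[ext]
structure PrimeFilter (T : Type*) [InverseSemigroupWithZero T] extends ProperFilter T where
  prime : ∀ {a b c : T}, Compatible a b → IsLUB {a, b} c → c ∈ carrier →
    a ∈ carrier ∨ b ∈ carrier

theorem isLUB_inv {T : Type*} [InverseSemigroupWithZero T] {a b c : T} (h : IsLUB {a, b} c) :
    IsLUB {a⁻¹, b⁻¹} c⁻¹ := by
  constructor
  · rintro x (rfl | rfl)
    · exact inv_le_inv' (h.1 (by simp))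
    · exact inv_le_inv' (h.1 (by simp))
  · intro x hx
    rw [inv_le_iff]
    apply h.2
    rintro y (rfl | rfl)
    · exact inv_le_iff.1 (hx (by simp))
    · exact inv_le_iff.1 (hx (by simp))

namespace PrimeFilter

variable {T : Type*} [InverseSemigroupWithZero T]

theorem toProperFilter_injective :
    Function.Injective (toProperFilter : PrimeFilter T → ProperFilter T) := by
  intro A B h
  exact PrimeFilter.ext (congrArg ProperFilter.carrier h)

instance : SetLike (PrimeFilter T) T where
  coe A := A.carrier
  coe_injective := fun _ _ h => PrimeFilter.ext h

theorem prime_invF (A : PrimeFilter T) {a b c : T} (hab : Compatible a b) (h : IsLUB {a, b} c)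
    (hc : c ∈ A.toProperFilter.invF.carrier) :
    a ∈ A.toProperFilter.invF.carrier ∨ b ∈ A.toProperFilter.invF.carrier :=
  A.prime hab.inv (isLUB_inv h) hc

theorem prime_compF [IsDistributive T] {A B : ProperFilter T} (hd : A.dF = B.rF)
    (hB : ∀ {a b c : T}, Compatible a b → IsLUB {a, b} c → c ∈ B.carrier →
      a ∈ B.carrier ∨ b ∈ B.carrier) {a b c : T} (hab : Compatible a b) (h : IsLUB {a, b} c)
    (hc : c ∈ (A.compF B hd).carrier) :
    a ∈ (A.compF B hd).carrier ∨ b ∈ (A.compF B hd).carrier := by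
  obtain ⟨x, hx, y, hy, h1⟩ := hc
  have h2 : x⁻¹ * c ∈ B.carrier :=
    B.upper (ProperFilter.restrict_right hd hx hy) (mul_le_mul_nat le_rfl h1)
  rcases hB ((Compatible.refl _).mul hab) (IsDistributive.mul_join a b c x⁻¹ hab h) h2 with h3 | h3
  · exact Or.inl ⟨x, hx, _, h3, mul_inv_le x a⟩
  · exact Or.inr ⟨x, hx, _, h3, mul_inv_le x b⟩

theorem dF_eq (A : ProperFilter T) :
    A.dF = A.invF.compF A (ProperFilter.dF_invF A) :=
  (ArrowGroupoid.inv_comp A _).symm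

theorem rF_eq (A : ProperFilter T) :
    A.rF = A.compF A.invF (ProperFilter.rF_invF A).symm :=
  (ArrowGroupoid.comp_inv A _).symm

variable [IsDistributive T]

/-- The groupoid of prime filters, with the operations of the groupoid of proper filters. -/
instance : ArrowGroupoid (PrimeFilter T) where
  d A := ⟨A.toProperFilter.dF, fun hab h hc => by
    rw [dF_eq] at hc ⊢
    exact prime_compF _ A.prime hab h hc⟩
  r A := ⟨A.toProperFilter.rF, fun hab h hc => by
    rw [rF_eq] at hc ⊢
    exact prime_compF _ A.prime_invF hab h hc⟩
  inv A := ⟨A.toProperFilter.invF, A.prime_invF⟩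
  comp A B h := ⟨A.toProperFilter.compF B.toProperFilter (congrArg toProperFilter h),
    prime_compF _ B.prime⟩
  d_r A := toProperFilter_injective (ArrowGroupoid.d_r _)
  r_d A := toProperFilter_injective (ArrowGroupoid.r_d _)
  d_inv A := toProperFilter_injective (ArrowGroupoid.d_inv _)
  r_inv A := toProperFilter_injective (ArrowGroupoid.r_inv _)
  d_comp A B h := toProperFilter_injective (ArrowGroupoid.d_comp _ _ _)
  r_comp A B h := toProperFilter_injective (ArrowGroupoid.r_comp _ _ _)
  comp_d A h := toProperFilter_injective (ArrowGroupoid.comp_d _ _)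
  r_comp_self A h := toProperFilter_injective (ArrowGroupoid.r_comp_self _ _)
  comp_inv A h := toProperFilter_injective (ArrowGroupoid.comp_inv _ _)
  inv_comp A h := toProperFilter_injective (ArrowGroupoid.inv_comp _ _)
  assoc A B C h h' k k' := toProperFilter_injective
    (ArrowGroupoid.assoc A.toProperFilter B.toProperFilter C.toProperFilter
      (congrArg toProperFilter h) (congrArg toProperFilter h')
      (congrArg toProperFilter k) (congrArg toProperFilter k'))

end PrimeFilter

section Booleanization

variable {T : Type*} [InverseSemigroupWithZero T] [IsDistributive T]

/-- `V_{s;t}`: the prime filters that contain `s` and omit `t`, as a partial bisection. -/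
def basicV (s t : T) : PartialBisection (PrimeFilter T) where
  carrier := {P | s ∈ P ∧ t ∉ P}
  d_inj := by
    intro A hA B hB h
    exact PrimeFilter.toProperFilter_injective
      (ProperFilter.eq_of_dF_eq hA.1 hB.1 (congrArg PrimeFilter.toProperFilter h))
  r_inj := by
    intro A hA B hB h
    exact PrimeFilter.toProperFilter_injective
      (ProperFilter.eq_of_rF_eq hA.1 hB.1 (congrArg PrimeFilter.toProperFilter h))

/-- The patch topology on the groupoid of prime filters: it has as a basis the sets `V_{s;t}`
where `t ≤ s`. -/
instance patchTopology : TopologicalSpace (PrimeFilter T) :=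
  TopologicalSpace.generateFrom {X | ∃ s t : T, t ≤ s ∧ X = (basicV s t : Set (PrimeFilter T))}

theorem basicV_inv (s t : T) : (basicV s t)⁻¹ = basicV s⁻¹ t⁻¹ := by
  apply PartialBisection.ext
  ext P
  change (s⁻¹ ∈ P.carrier ∧ t⁻¹ ∉ P.carrier) ↔ (s⁻¹ ∈ P.carrier ∧ t⁻¹ ∉ P.carrier)
  exact Iff.rfl

/-- `V_{s;t} V_{u;v} = V_{su; sv ∨ tu}`. -/
theorem basicV_mul {s t u v w : T} (ht : t ≤ s) (hv : v ≤ u) (hw : IsLUB {s * v, t * u} w) :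
    basicV s t * basicV u v = basicV (s * u) w := by
  have hcomp : Compatible (s * v) (t * u) :=
    (Compatible.refl (s * u)).mono (mul_le_mul_nat le_rfl hv) (mul_le_mul_nat ht le_rfl)
  apply PartialBisection.ext
  ext C
  constructor
  · rintro ⟨A, ⟨hsA, htA⟩, B, ⟨huB, hvB⟩, h, rfl⟩
    have hd : A.toProperFilter.dF = B.toProperFilter.rF := congrArg PrimeFilter.toProperFilter h
    refine ⟨⟨s, hsA, u, huB, le_rfl⟩, fun hwC => ?_⟩
    rcases (ArrowGroupoid.comp A B h).prime hcomp hw hwC with ⟨a, ha, b, hb, h1⟩ | ⟨a, ha, b, hb, h1⟩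
    · obtain ⟨x, hx, h2, h3⟩ := A.toProperFilter.directed ha hsA
      apply hvB
      refine B.upper (ProperFilter.restrict_right hd hx hb) ?_
      exact (mul_le_mul_nat (inv_le_inv' h3) ((mul_le_mul_nat h2 le_rfl).trans h1)).trans
        (inv_mul_le s v)
    · obtain ⟨x, hx, h2, h3⟩ := B.toProperFilter.directed hb huB
      apply htA
      refine A.upper (ProperFilter.restrict_left hd ha hx) ?_
      refine (mul_le_mul_nat ((mul_le_mul_nat le_rfl h2).trans h1) (inv_le_inv' h3)).trans ?_
      rw [mul_assoc]
      exact mul_idem_le t (idem_mul_inv u)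
  · rintro ⟨hsu, hwC⟩
    have hsu' : s * u ∈ C.carrier := hsu
    have key : ∀ c ∈ C.carrier, ∃ x ∈ C.carrier, x ≤ c ∧ x ≤ s * u ∧ s * (s⁻¹ * x) = x := by
      intro c hc
      obtain ⟨x, hx, h1, h2⟩ := C.directed hc hsu'
      refine ⟨x, hx, h1, h2, ?_⟩
      obtain ⟨e, he, rfl⟩ := h2
      calc s * (s⁻¹ * (s * u * e)) = (s * s⁻¹ * s) * u * e := by simp only [mul_assoc]
        _ = _ := by rw [mul_inv_mul]
    let B : PrimeFilter T :=
      { carrier := {x | ∃ c ∈ C.carrier, s⁻¹ * c ≤ x}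
        nonempty := ⟨_, s * u, hsu', le_rfl⟩
        upper := by
          rintro a b ⟨c, hc, h1⟩ h2
          exact ⟨c, hc, h1.trans h2⟩
        directed := by
          rintro a b ⟨c, hc, h1⟩ ⟨c', hc', h1'⟩
          obtain ⟨x, hx, h2, h3⟩ := C.directed hc hc'
          exact ⟨s⁻¹ * x, ⟨x, hx, le_rfl⟩, (mul_le_mul_nat le_rfl h2).trans h1,
            (mul_le_mul_nat le_rfl h3).trans h1'⟩
        zero_notMem := by
          rintro ⟨c, hc, h1⟩
          obtain ⟨x, hx, h2, h3, h4⟩ := key c hc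
          have h5 : s⁻¹ * x = 0 := eq_zero_of_le ((mul_le_mul_nat le_rfl h2).trans h1)
          rw [h5, mul_zero] at h4
          exact C.zero_notMem (h4 ▸ hx)
        prime := by
          rintro a b c hab hl ⟨x, hx, h1⟩
          obtain ⟨y, hy, h2, h3, h4⟩ := key x hx
          have h5 : s * c ∈ C.carrier := by
            refine C.upper hy ?_
            rw [← h4]
            exact mul_le_mul_nat le_rfl ((mul_le_mul_nat le_rfl h2).trans h1)
          rcases C.prime ((Compatible.refl s).mul hab) (IsDistributive.mul_join a b c s hab hl) h5
            with h6 | h6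
          · exact Or.inl ⟨_, h6, inv_mul_le s a⟩
          · exact Or.inr ⟨_, h6, inv_mul_le s b⟩ }
    have huB : u ∈ B.carrier := ⟨s * u, hsu', inv_mul_le s u⟩
    have hd : C.toProperFilter.dF = B.toProperFilter.dF := by
      apply ProperFilter.ext
      ext x
      rw [ProperFilter.mem_dF, ProperFilter.mem_dF]
      have e1 : ∀ c : T, s * (s⁻¹ * c) = c → (s⁻¹ * c)⁻¹ * (s⁻¹ * c) = c⁻¹ * c := by
        intro c hc
        rw [mul_inv_rev', inv_inv', mul_assoc, hc]
      constructor
      · rintro ⟨c, hc, h1⟩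
        obtain ⟨y, hy, h2, h3, h4⟩ := key c hc
        refine ⟨s⁻¹ * y, ⟨y, hy, le_rfl⟩, ?_⟩
        rw [e1 y h4]
        exact (mul_le_mul_nat (inv_le_inv' h2) h2).trans h1
      · rintro ⟨b, ⟨c, hc, h1⟩, h2⟩
        obtain ⟨y, hy, h3, h4, h5⟩ := key c hc
        refine ⟨y, hy, le_trans ?_ h2⟩
        rw [← e1 y h5]
        have h6 : s⁻¹ * y ≤ b := (mul_le_mul_nat le_rfl h3).trans h1
        exact mul_le_mul_nat (inv_le_inv' h6) h6
    have hd' : ArrowGroupoid.d C = ArrowGroupoid.d B := PrimeFilter.toProperFilter_injective hd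
    have hCB : ArrowGroupoid.d C = ArrowGroupoid.r (ArrowGroupoid.inv B) := by
      rw [ArrowGroupoid.r_inv, hd']
    have hAB : ArrowGroupoid.d (ArrowGroupoid.comp C (ArrowGroupoid.inv B) hCB) =
        ArrowGroupoid.r B := by
      rw [ArrowGroupoid.d_comp, ArrowGroupoid.d_inv]
    have hC : C = ArrowGroupoid.comp (ArrowGroupoid.comp C (ArrowGroupoid.inv B) hCB) B hAB := by
      have h1 := ArrowGroupoid.comp_inv_cancel C (ArrowGroupoid.inv B) hCB
        (by rw [ArrowGroupoid.r_inv, ArrowGroupoid.d_comp])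
      rw [ArrowGroupoid.comp_congr rfl (ArrowGroupoid.inv_inv B)] at h1
      exact h1.symm
    refine ⟨ArrowGroupoid.comp C (ArrowGroupoid.inv B) hCB, ⟨?_, ?_⟩, B, ⟨huB, ?_⟩, hAB, hC⟩
    · refine ⟨s * u, hsu', (s⁻¹ * (s * u))⁻¹, ?_, ?_⟩
      · change (s⁻¹ * (s * u))⁻¹⁻¹ ∈ B.carrier
        rw [inv_inv']
        exact ⟨s * u, hsu', le_rfl⟩
      · rw [mul_inv_rev', inv_inv', ← mul_assoc]
        exact idem_mul_le s (idem_mul_inv (s * u))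
    · intro htA
      apply hwC
      have h1 : t * u ∈ C.carrier := by
        rw [hC]
        exact ⟨t, htA, u, huB, le_rfl⟩
      exact C.upper h1 (hw.1 (by simp))
    · rintro ⟨c, hc, h1⟩
      apply hwC
      obtain ⟨y, hy, h2, h3, h4⟩ := key c hc
      have h5 : s * v ∈ C.carrier := by
        refine C.upper hy ?_
        rw [← h4]
        exact mul_le_mul_nat le_rfl ((mul_le_mul_nat le_rfl h2).trans h1)
      exact C.upper h5 (hw.1 (by simp))

theorem compatible_of_subset {G : Type*} [ArrowGroupoid G] {X Y Z : PartialBisection G}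
    (hX : X.carrier ⊆ Z.carrier) (hY : Y.carrier ⊆ Z.carrier) : Compatible X Y := by
  have hle : ∀ X : PartialBisection G, X.carrier ⊆ Z.carrier → X ≤ Z := by
    intro X hX
    refine ⟨X⁻¹ * X, idem_inv_mul X, ?_⟩
    apply PartialBisection.ext
    ext w
    constructor
    · intro hw
      have hwX : w ∈ (X * (X⁻¹ * X)).carrier := by rw [mul_inv_mul']; exact hw
      obtain ⟨x, hx, e, he, h, rfl⟩ := hwX
      exact ⟨x, hX hx, e, he, h, rfl⟩
    · rintro ⟨z, hz, _, ⟨x, hx, y, hy, k, rfl⟩, h, rfl⟩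
      have hix : ArrowGroupoid.inv x ∈ X.carrier := hx
      have e1 : ArrowGroupoid.inv x = y :=
        Z.r_inj (hX hix) (hX hy) (by rw [ArrowGroupoid.r_inv, k])
      have e2 : z = ArrowGroupoid.inv x :=
        Z.d_inj hz (hX hix) (by rw [ArrowGroupoid.d_inv, h, ArrowGroupoid.r_comp])
      subst e1
      subst e2
      rw [ArrowGroupoid.comp_congr rfl (ArrowGroupoid.comp_inv x k),
        ArrowGroupoid.comp_congr rfl (ArrowGroupoid.d_inv x).symm, ArrowGroupoid.comp_d]
      exact hix
  exact (Compatible.refl Z).mono (hle X hX) (hle Y hY)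

variable (T) in
/-- The Booleanization of a distributive inverse semigroup `T`: the unions, in the inverse
semigroup of partial bisections of the groupoid of prime filters of `T`, of finite compatible sets
of partial bisections `V_{s;t}` where `t ≤ s`. -/
def booleanizationOfDistributive : InverseSubsemigroup (PartialBisection (PrimeFilter T)) where
  carrier := {X | ∃ F : Set (PartialBisection (PrimeFilter T)), F.Finite ∧
    (∀ Y ∈ F, ∃ s t : T, t ≤ s ∧ Y = basicV s t) ∧ (∀ Y ∈ F, ∀ Z ∈ F, Compatible Y Z) ∧
    X.carrier = ⋃ Y ∈ F, Y.carrier}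
  zero_mem := by
    refine ⟨∅, Set.finite_empty, by simp, by simp, ?_⟩
    rw [Set.biUnion_empty]
    rfl
  mul_mem := by
    rintro X X' ⟨F, hF, hV, hc, hX⟩ ⟨F', hF', hV', hc', hX'⟩
    have hU : (X * X').carrier = ⋃ Y ∈ Set.image2 (fun x y => x * y) F F', Y.carrier := by
      ext w
      simp only [Set.mem_iUnion, Set.mem_image2, exists_prop]
      constructor
      · rintro ⟨x, hx, y, hy, h, rfl⟩
        rw [hX] at hx
        rw [hX'] at hy
        simp only [Set.mem_iUnion, exists_prop] at hx hy
        obtain ⟨Y, hY, hx⟩ := hx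
        obtain ⟨Y', hY', hy⟩ := hy
        exact ⟨Y * Y', ⟨Y, hY, Y', hY', rfl⟩, x, hx, y, hy, h, rfl⟩
      · rintro ⟨_, ⟨Y, hY, Y', hY', rfl⟩, x, hx, y, hy, h, rfl⟩
        refine ⟨x, ?_, y, ?_, h, rfl⟩
        · rw [hX]; exact Set.mem_biUnion hY hx
        · rw [hX']; exact Set.mem_biUnion hY' hy
    refine ⟨Set.image2 (fun x y => x * y) F F', hF.image2 _ hF', ?_, ?_, hU⟩
    · rintro _ ⟨Y, hY, Y', hY', rfl⟩
      obtain ⟨s, t, hst, rfl⟩ := hV Y hY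
      obtain ⟨u, v, huv, rfl⟩ := hV' Y' hY'
      have h1 : s * v ≤ s * u := mul_le_mul_nat le_rfl huv
      have h2 : t * u ≤ s * u := mul_le_mul_nat hst le_rfl
      obtain ⟨w, hw⟩ := IsDistributive.exists_join (s * v) (t * u)
        ((Compatible.refl (s * u)).mono h1 h2)
      refine ⟨s * u, w, hw.2 ?_, basicV_mul hst huv hw⟩
      rintro x (rfl | rfl)
      · exact h1
      · exact h2
    · intro Y hY Z hZ
      refine compatible_of_subset (Z := X * X') ?_ ?_
      · rw [hU]; exact Set.subset_biUnion_of_mem (u := PartialBisection.carrier) hY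
      · rw [hU]; exact Set.subset_biUnion_of_mem (u := PartialBisection.carrier) hZ
  inv_mem := by
    rintro X ⟨F, hF, hV, hc, hX⟩
    refine ⟨(fun Y => Y⁻¹) '' F, hF.image _, ?_, ?_, ?_⟩
    · rintro _ ⟨Y, hY, rfl⟩
      obtain ⟨s, t, hst, rfl⟩ := hV Y hY
      exact ⟨s⁻¹, t⁻¹, inv_le_inv' hst, basicV_inv s t⟩
    · rintro _ ⟨Y, hY, rfl⟩ _ ⟨Z, hZ, rfl⟩
      exact (hc Y hY Z hZ).inv
    · ext w
      simp only [Set.mem_iUnion, Set.mem_image, exists_prop]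
      constructor
      · intro hw
        have hw' : ArrowGroupoid.inv w ∈ X.carrier := hw
        rw [hX] at hw'
        simp only [Set.mem_iUnion, exists_prop] at hw'
        obtain ⟨Y, hY, hw'⟩ := hw'
        exact ⟨Y⁻¹, ⟨Y, hY, rfl⟩, hw'⟩
      · rintro ⟨_, ⟨Y, hY, rfl⟩, hw⟩
        change ArrowGroupoid.inv w ∈ X.carrier
        rw [hX]
        exact Set.mem_biUnion hY hw

end Booleanization

/-! ### The distributive completion -/

/-- The distributive completion of `S`: the order ideals `{a₁, …, aₘ}↓` generated by nonempty
finite compatible subsets of `S`, under multiplication of subsets. -/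
@[ext]
structure DistributiveCompletion (S : Type*) [InverseSemigroupWithZero S] where
  carrier : Set S
  fg : ∃ F : Set S, F.Finite ∧ F.Nonempty ∧ (∀ a ∈ F, ∀ b ∈ F, Compatible a b) ∧
    carrier = {s | ∃ a ∈ F, s ≤ a}

namespace DistributiveCompletion

variable {S : Type*} [InverseSemigroupWithZero S]

instance : SetLike (DistributiveCompletion S) S where
  coe A := A.carrier
  coe_injective := fun _ _ h => DistributiveCompletion.ext h

theorem lower (A : DistributiveCompletion S) {s t : S} (ht : t ∈ A.carrier) (h : s ≤ t) :
    s ∈ A.carrier := by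
  obtain ⟨F, _, _, _, hA⟩ := A.fg
  rw [hA] at ht ⊢
  obtain ⟨a, ha, h'⟩ := ht
  exact ⟨a, ha, h.trans h'⟩

theorem compatible (A : DistributiveCompletion S) {s t : S} (hs : s ∈ A.carrier)
    (ht : t ∈ A.carrier) : Compatible s t := by
  obtain ⟨F, _, _, hc, hA⟩ := A.fg
  rw [hA] at hs ht
  obtain ⟨a, ha, h⟩ := hs
  obtain ⟨b, hb, h'⟩ := ht
  exact (hc a ha b hb).mono h h'

theorem zero_mem (A : DistributiveCompletion S) : (0 : S) ∈ A.carrier := by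
  obtain ⟨F, _, ⟨a, ha⟩, _, hA⟩ := A.fg
  rw [hA]
  exact ⟨a, ha, zero_le' a⟩

/-- The principal order ideal `s↓`. -/
def principal (s : S) : DistributiveCompletion S where
  carrier := {x | x ≤ s}
  fg := ⟨{s}, Set.finite_singleton s, Set.singleton_nonempty s, by
    rintro a rfl b rfl
    exact Compatible.refl _, by simp⟩

instance : Mul (DistributiveCompletion S) where
  mul A B :=
    { carrier := {s | ∃ a ∈ A.carrier, ∃ b ∈ B.carrier, s = a * b}
      fg := by
        obtain ⟨F, hF, hn, hc, hA⟩ := A.fg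
        obtain ⟨F', hF', hn', hc', hB⟩ := B.fg
        refine ⟨Set.image2 (fun x y => x * y) F F', hF.image2 _ hF', hn.image2 hn', ?_, ?_⟩
        · rintro _ ⟨a, ha, b, hb, rfl⟩ _ ⟨a', ha', b', hb', rfl⟩
          exact (hc a ha a' ha').mul (hc' b hb b' hb')
        · ext s
          rw [hA, hB]
          constructor
          · rintro ⟨a, ⟨x, hx, h1⟩, b, ⟨y, hy, h2⟩, rfl⟩
            exact ⟨x * y, ⟨x, hx, y, hy, rfl⟩, mul_le_mul_nat h1 h2⟩
          · rintro ⟨_, ⟨x, hx, y, hy, rfl⟩, e, he, rfl⟩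
            exact ⟨x, ⟨x, hx, le_rfl⟩, y * e, ⟨y, hy, mul_idem_le y he⟩, mul_assoc _ _ _⟩ }

instance : Zero (DistributiveCompletion S) where
  zero := principal 0

instance : Inv (DistributiveCompletion S) where
  inv A :=
    { carrier := {s | s⁻¹ ∈ A.carrier}
      fg := by
        obtain ⟨F, hF, hn, hc, hA⟩ := A.fg
        refine ⟨(fun x => x⁻¹) '' F, hF.image _, hn.image _, ?_, ?_⟩
        · rintro _ ⟨a, ha, rfl⟩ _ ⟨b, hb, rfl⟩
          exact (hc a ha b hb).inv
        · ext s
          rw [hA]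
          constructor
          · rintro ⟨a, ha, h⟩
            exact ⟨a⁻¹, ⟨a, ha, rfl⟩, inv_le_iff.1 h⟩
          · rintro ⟨_, ⟨a, ha, rfl⟩, h⟩
            exact ⟨a, ha, inv_le_iff.2 h⟩ }

theorem mem_mul {A B : DistributiveCompletion S} {s : S} :
    s ∈ (A * B).carrier ↔ ∃ a ∈ A.carrier, ∃ b ∈ B.carrier, s = a * b := Iff.rfl

theorem mem_inv {A : DistributiveCompletion S} {s : S} : s ∈ (A⁻¹).carrier ↔ s⁻¹ ∈ A.carrier :=
  Iff.rfl

protected theorem mul_assoc (A B C : DistributiveCompletion S) : A * B * C = A * (B * C) := by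
  apply DistributiveCompletion.ext
  ext s
  constructor
  · rintro ⟨_, ⟨a, ha, b, hb, rfl⟩, c, hc, rfl⟩
    exact ⟨a, ha, b * c, ⟨b, hb, c, hc, rfl⟩, mul_assoc a b c⟩
  · rintro ⟨a, ha, _, ⟨b, hb, c, hc, rfl⟩, rfl⟩
    exact ⟨a * b, ⟨a, ha, b, hb, rfl⟩, c, hc, (mul_assoc a b c).symm⟩

/-- Idempotents of the completion consist of idempotents. -/
theorem idem_of_mem {A : DistributiveCompletion S} (hA : A * A = A) {a : S}
    (ha : a ∈ A.carrier) : IsIdempotentElem a := by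
  have ha' : a ∈ (A * A).carrier := by rw [hA]; exact ha
  obtain ⟨b, hb, c, hc, e⟩ := ha'
  have hab := A.compatible ha hb
  have hac := A.compatible ha hc
  have h1 : a ≤ b := by
    have e1 : a = b * (b⁻¹ * a) := by
      rw [e]
      calc b * c = (b * b⁻¹ * b) * c := by rw [mul_inv_mul]
        _ = _ := by simp only [mul_assoc]
    exact ⟨_, hab.symm.1, e1⟩
  have h2 : a ≤ c := by
    have e1 : a = a * c⁻¹ * c := by
      rw [e]
      calc b * c = b * (c * c⁻¹ * c) := by rw [mul_inv_mul]
        _ = _ := by simp only [mul_assoc]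
    exact le_iff_left.2 ⟨_, hac.2, e1⟩
  have h3 : b * a = a := by
    calc b * a = b * (c * (a⁻¹ * a)) := by rw [eq_mul_of_le h2]
      _ = (b * c) * (a⁻¹ * a) := (mul_assoc _ _ _).symm
      _ = a := by rw [← e, mul_inv_mul']
  have h4 : b⁻¹ * a = a⁻¹ * a := by
    calc b⁻¹ * a = b⁻¹ * (b * (a⁻¹ * a)) := by rw [eq_mul_of_le h1]
      _ = (b⁻¹ * b) * (a⁻¹ * a) := (mul_assoc _ _ _).symm
      _ = (a⁻¹ * a) * (b⁻¹ * b) := idem_comm (idem_inv_mul b) (idem_inv_mul a)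
      _ = a⁻¹ * (a * (b⁻¹ * b)) := mul_assoc _ _ _
      _ = a⁻¹ * a := by
        congr 1
        obtain ⟨f, hf, h⟩ := le_iff_left.1 h1
        rw [h, mul_assoc, mul_inv_mul']
  have h5 : a⁻¹ * a ≤ a := by
    have e1 : a⁻¹ * a = (b⁻¹ * b) * a := by
      rw [mul_assoc, h3, h4]
    rw [e1]
    exact idem_mul_le a (idem_inv_mul b)
  have h6 : a = a⁻¹ * a := by
    have e1 := eq_mul_of_le h5
    rw [inv_idem (idem_inv_mul a), (idem_inv_mul a).eq, mul_inv_mul'] at e1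
    exact e1
  rw [h6]
  exact idem_inv_mul a

protected theorem idem_comm {A B : DistributiveCompletion S} (hA : A * A = A) (hB : B * B = B) :
    A * B = B * A := by
  apply DistributiveCompletion.ext
  ext s
  constructor
  · rintro ⟨a, ha, b, hb, rfl⟩
    exact ⟨b, hb, a, ha, idem_comm (idem_of_mem hA ha) (idem_of_mem hB hb)⟩
  · rintro ⟨b, hb, a, ha, rfl⟩
    exact ⟨a, ha, b, hb, idem_comm (idem_of_mem hB hb) (idem_of_mem hA ha)⟩

protected theorem mul_inv_mul (A : DistributiveCompletion S) : A * A⁻¹ * A = A := by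
  apply DistributiveCompletion.ext
  ext s
  constructor
  · rintro ⟨_, ⟨a, ha, b, hb, rfl⟩, c, hc, rfl⟩
    have h1 : IsIdempotentElem (a * b) := by
      have := (A.compatible ha hb).2
      rwa [inv_inv'] at this
    exact A.lower hc (idem_mul_le c h1)
  · intro hs
    exact ⟨s * s⁻¹, ⟨s, hs, s⁻¹, by rw [mem_inv, inv_inv']; exact hs, rfl⟩, s, hs,
      (mul_inv_mul s).symm⟩

protected theorem inv_inv (A : DistributiveCompletion S) : A⁻¹⁻¹ = A := by
  apply DistributiveCompletion.ext
  ext s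
  rw [mem_inv, mem_inv, inv_inv']

instance : InverseSemigroupWithZero (DistributiveCompletion S) where
  mul_assoc := DistributiveCompletion.mul_assoc
  zero_mul A := by
    apply DistributiveCompletion.ext
    ext s
    constructor
    · rintro ⟨a, ha, b, hb, rfl⟩
      change a * b ≤ 0
      rw [eq_zero_of_le (a := a) ha, zero_mul]
    · intro hs
      have hs' : s = 0 := eq_zero_of_le hs
      exact ⟨0, le_refl (0 : S), 0, A.zero_mem, by rw [hs', mul_zero]⟩
  mul_zero A := by
    apply DistributiveCompletion.ext
    ext s
    constructor
    · rintro ⟨a, ha, b, hb, rfl⟩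
      change a * b ≤ 0
      rw [eq_zero_of_le (a := b) hb, mul_zero]
    · intro hs
      have hs' : s = 0 := eq_zero_of_le hs
      exact ⟨0, A.zero_mem, 0, le_refl (0 : S), by rw [hs', mul_zero]⟩
  mul_inv_mul := DistributiveCompletion.mul_inv_mul
  inv_mul_inv A := by
    have := DistributiveCompletion.mul_inv_mul A⁻¹
    rwa [DistributiveCompletion.inv_inv] at this
  inv_unique A B h1 h2 := by
    have m := @DistributiveCompletion.mul_assoc S _
    have h3 : A * A⁻¹ * A = A := DistributiveCompletion.mul_inv_mul A
    have h4 : A⁻¹ * A * A⁻¹ = A⁻¹ := by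
      have := DistributiveCompletion.mul_inv_mul A⁻¹
      rwa [DistributiveCompletion.inv_inv] at this
    have i1 : (A * B) * (A * B) = A * B := by rw [← m, h1]
    have i2 : (A * A⁻¹) * (A * A⁻¹) = A * A⁻¹ := by rw [← m, h3]
    have i3 : (B * A) * (B * A) = B * A := by rw [← m, h2]
    have i4 : (A⁻¹ * A) * (A⁻¹ * A) = A⁻¹ * A := by rw [← m, h4]
    have c1 := DistributiveCompletion.idem_comm i1 i2
    have c2 := DistributiveCompletion.idem_comm i3 i4
    calc B = B * (A * A⁻¹ * A) * B := by rw [h3, h2]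
      _ = B * ((A * A⁻¹) * (A * B)) := by simp only [m]
      _ = (B * A * B) * (A * A⁻¹) := by rw [← c1]; simp only [m]
      _ = B * A * A⁻¹ := by rw [h2]; simp only [m]
      _ = (B * A) * (A⁻¹ * A * A⁻¹) := by rw [h4]
      _ = ((B * A) * (A⁻¹ * A)) * A⁻¹ := by simp only [m]
      _ = A⁻¹ * (A * B * A) * A⁻¹ := by rw [c2]; simp only [m]
      _ = A⁻¹ := by rw [h1, h4]

/-- The natural partial order of the completion is inclusion. -/
theorem le_iff_subset {A B : DistributiveCompletion S} : A ≤ B ↔ A.carrier ⊆ B.carrier := by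
  constructor
  · rintro ⟨E, hE, rfl⟩ s ⟨b, hb, e, he, rfl⟩
    exact B.lower hb (mul_idem_le b (idem_of_mem hE.eq he))
  · intro h
    refine ⟨A⁻¹ * A, idem_inv_mul A, ?_⟩
    apply DistributiveCompletion.ext
    ext s
    constructor
    · intro hs
      exact ⟨s, h hs, s⁻¹ * s, ⟨s⁻¹, by rw [mem_inv, inv_inv']; exact hs, s, hs, rfl⟩,
        (mul_inv_mul' s).symm⟩
    · rintro ⟨b, hb, _, ⟨x, hx, a, ha, rfl⟩, rfl⟩
      have h1 : IsIdempotentElem (b * x) := by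
        have := (B.compatible hb (h hx)).2
        rwa [inv_inv'] at this
      rw [← mul_assoc]
      exact A.lower ha (idem_mul_le a h1)

/-- Compatible elements of the completion have their union as join. -/
theorem exists_union {A B : DistributiveCompletion S} (h : Compatible A B) :
    ∃ C : DistributiveCompletion S, C.carrier = A.carrier ∪ B.carrier := by
  have hc : ∀ a ∈ A.carrier, ∀ b ∈ B.carrier, Compatible a b := by
    intro a ha b hb
    constructor
    · exact idem_of_mem h.1.eq ⟨a⁻¹, by rw [mem_inv, inv_inv']; exact ha, b, hb, rfl⟩
    · exact idem_of_mem h.2.eq ⟨a, ha, b⁻¹, by rw [mem_inv, inv_inv']; exact hb, rfl⟩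
  obtain ⟨F, hF, hn, hcF, hA⟩ := A.fg
  obtain ⟨F', hF', hn', hcF', hB⟩ := B.fg
  have hFA : ∀ a ∈ F, a ∈ A.carrier := fun a ha => by rw [hA]; exact ⟨a, ha, le_rfl⟩
  have hFB : ∀ a ∈ F', a ∈ B.carrier := fun a ha => by rw [hB]; exact ⟨a, ha, le_rfl⟩
  refine ⟨⟨A.carrier ∪ B.carrier, F ∪ F', hF.union hF', hn.inl, ?_, ?_⟩, rfl⟩
  · rintro a (ha | ha) b (hb | hb)
    · exact hcF a ha b hb
    · exact hc a (hFA a ha) b (hFB b hb)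
    · exact (hc b (hFA b hb) a (hFB a ha)).symm
    · exact hcF' a ha b hb
  · rw [hA, hB]
    ext s
    constructor
    · rintro (⟨a, ha, h⟩ | ⟨a, ha, h⟩)
      · exact ⟨a, Or.inl ha, h⟩
      · exact ⟨a, Or.inr ha, h⟩
    · rintro ⟨a, ha | ha, h⟩
      · exact Or.inl ⟨a, ha, h⟩
      · exact Or.inr ⟨a, ha, h⟩

theorem isLUB_of_union {A B C : DistributiveCompletion S}
    (h : C.carrier = A.carrier ∪ B.carrier) : IsLUB {A, B} C := by
  constructor
  · rintro X (rfl | rfl)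
    · rw [le_iff_subset, h]; exact Set.subset_union_left
    · rw [le_iff_subset, h]; exact Set.subset_union_right
  · intro X hX
    rw [le_iff_subset, h]
    exact Set.union_subset (le_iff_subset.1 (hX (by simp))) (le_iff_subset.1 (hX (by simp)))

theorem union_of_isLUB {A B C : DistributiveCompletion S} (hAB : Compatible A B)
    (h : IsLUB {A, B} C) : C.carrier = A.carrier ∪ B.carrier := by
  obtain ⟨D, hD⟩ := exists_union hAB
  rw [h.unique (isLUB_of_union hD), hD]

instance : IsDistributive (DistributiveCompletion S) where
  exists_join A B h := by
    obtain ⟨C, hC⟩ := exists_union h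
    exact ⟨C, isLUB_of_union hC⟩
  mul_join A B C X hAB h := by
    apply isLUB_of_union
    have hC := union_of_isLUB hAB h
    ext s
    constructor
    · rintro ⟨x, hx, c, hc, rfl⟩
      rw [hC] at hc
      rcases hc with hc | hc
      · exact Or.inl ⟨x, hx, c, hc, rfl⟩
      · exact Or.inr ⟨x, hx, c, hc, rfl⟩
    · rintro (⟨x, hx, c, hc, rfl⟩ | ⟨x, hx, c, hc, rfl⟩)
      · exact ⟨x, hx, c, by rw [hC]; exact Or.inl hc, rfl⟩
      · exact ⟨x, hx, c, by rw [hC]; exact Or.inr hc, rfl⟩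
  join_mul A B C X hAB h := by
    apply isLUB_of_union
    have hC := union_of_isLUB hAB h
    ext s
    constructor
    · rintro ⟨c, hc, x, hx, rfl⟩
      rw [hC] at hc
      rcases hc with hc | hc
      · exact Or.inl ⟨c, hc, x, hx, rfl⟩
      · exact Or.inr ⟨c, hc, x, hx, rfl⟩
    · rintro (⟨c, hc, x, hx, rfl⟩ | ⟨c, hc, x, hx, rfl⟩)
      · exact ⟨c, by rw [hC]; exact Or.inl hc, x, hx, rfl⟩
      · exact ⟨c, by rw [hC]; exact Or.inr hc, x, hx, rfl⟩

end DistributiveCompletion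

/-- The Booleanization `B(S)` of an inverse semigroup with zero `S`: the Booleanization of its
distributive completion. -/
abbrev Booleanization (S : Type*) [InverseSemigroupWithZero S] :
    InverseSubsemigroup (PartialBisection (PrimeFilter (DistributiveCompletion S))) :=
  booleanizationOfDistributive (DistributiveCompletion S)

/-- The map `β : S → B(S)`, sending `s` to the set of all prime filters of the distributive
completion that contain `s↓`. -/
def beta {S : Type*} [InverseSemigroupWithZero S] (s : S) : Booleanization S :=
  ⟨basicV (DistributiveCompletion.principal s) 0, {basicV (DistributiveCompletion.principal s) 0},
    Set.finite_singleton _, by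
      rintro _ rfl
      exact ⟨_, _, zero_le' _, rfl⟩, by
      rintro _ rfl _ rfl
      exact Compatible.refl _, by simp⟩

/-- The compact-open partial bisections of a topological groupoid. -/
def KB (G : Type*) [ArrowGroupoid G] [TopologicalSpace G] : Set (PartialBisection G) :=
  {X | IsCompact (X : Set G) ∧ IsOpen (X : Set G)}

end InvSgp

/-! ### Restriction inside a filter, and translates of identity filters -/

namespace InvSgp

open InverseSemigroupWithZero ArrowGroupoid TopologicalSpace

namespace ProperFilter

variable {S : Type*} [InverseSemigroupWithZero S]

/-! Write U_a for the set of proper filters containing a. The argument rests on one fact: a filter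
that contains c contains a exactly when it contains the restriction a(c⁻¹c) (`mul_inv_mul_mem`,
`mem_of_mul_inv_mul_mem`). If a and c lie below a common b, then a(c⁻¹c) ≤ b(c⁻¹c) = c. So on U_c
the elements to be avoided can be moved below c, which makes the sets U_{a;F} a basis. The same
restrictions supply the common lower bounds needed to define the limit of an ultrafilter on U_a, so
every U_{a;F} is compact (`isCompact_setOf_mem`, `isCompact_basicU`).

On U_a the map d is injective, and an identity E containing a⁻¹a is the domain of (aE)↑
(`dF_translate`). This computes d(U_{a;F}) and shows that d is open, hence a local homeomorphism. An
identity is generated by its idempotents, and these separate distinct identities by disjoint open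
sets. The space of identities is therefore Hausdorff with a basis of compact-open sets.

An element of D(S) is a finite join of principal ideals, so a prime filter containing it contains
one of these principal ideals (`exists_principal_mem`). Hence P ↦ {a : a↓ ∈ P} inverts Φ. It is a
homeomorphism because Φ⁻¹(V_{a↓;F↓}) = U_{a;F}, while every Φ⁻¹(V_{A;B}) with B ≤ A is open
(`isOpen_preimage_basicV`).

A compact-open partial bisection of the universal groupoid is a finite union of sets U_{a;F}. These
are pullbacks of sets V_{s;t}, compatible because they lie in one partial bisection. Conversely,
pullbacks of V_{s;t} are compact and open. So Φ⁻¹ matches B(S) with KB (`comap_mem_KB_iff`), and KB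
inherits closure under products and inverses from B(S). Its order is inclusion and its compatible
joins are unions; differences of idempotents stay compact-open because the space of identities is
Hausdorff. -/

theorem mul_inv_mul_mem {A : ProperFilter S} {a c : S} (ha : a ∈ A) (hc : c ∈ A) :
    a * (c⁻¹ * c) ∈ A := by
  obtain ⟨x, hx, h1, h2⟩ := A.directed ha hc
  refine A.upper hx ?_
  calc x = x * (x⁻¹ * x) := (mul_inv_mul' x).symm
    _ ≤ a * (c⁻¹ * c) := mul_le_mul_nat h1 (mul_le_mul_nat (inv_le_inv' h2) h2)

theorem mem_of_mul_inv_mul_mem {A : ProperFilter S} {a c : S} (h : a * (c⁻¹ * c) ∈ A) : a ∈ A :=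
  A.upper h (mul_idem_le a (idem_inv_mul c))

/-- The filter `(aE)↑`, where `E` is an identity containing `a⁻¹a`. -/
def translate (a : S) (E : ProperFilter S) (ha : a⁻¹ * a ∈ E) (hE : E.dF = E) :
    ProperFilter S where
  carrier := {s | ∃ e ∈ E, a * e ≤ s}
  nonempty := ⟨_, _, ha, le_rfl⟩
  upper := by
    rintro s t ⟨e, he, h⟩ h'
    exact ⟨e, he, h.trans h'⟩
  directed := by
    rintro s t ⟨e, he, h⟩ ⟨f, hf, h'⟩
    obtain ⟨c, hc, h1, h2⟩ := E.directed he hf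
    exact ⟨a * c, ⟨c, hc, le_rfl⟩, (mul_le_mul_nat le_rfl h1).trans h,
      (mul_le_mul_nat le_rfl h2).trans h'⟩
  zero_notMem := by
    rintro ⟨e, he, h⟩
    -- If ae were 0, then so would be a⁻¹(ae)e⁻¹. But this element is a⁻¹a restricted by the
    -- idempotent ee⁻¹, which lies in r(E) = E.
    have h1 : a⁻¹ * a * (e * e⁻¹) ∈ E := by
      have h2 : (a⁻¹ * a) ∈ E.dF := by rw [hE]; exact ha
      have h3 : e * e⁻¹ ∈ E.rF := ⟨e, he, e, he, le_rfl⟩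
      have h4 : E.rF = E := by rw [← hE, rF_dF, hE]
      rw [h4] at h3
      have h5 := mul_inv_mul_mem ha h3
      rwa [inv_idem (idem_mul_inv e), (idem_mul_inv e).eq] at h5
    have h2 : a⁻¹ * a * (e * e⁻¹) = 0 := by
      calc a⁻¹ * a * (e * e⁻¹) = a⁻¹ * (a * e) * e⁻¹ := by simp only [mul_assoc]
        _ = 0 := by rw [eq_zero_of_le h, mul_zero, zero_mul]
    rw [h2] at h1
    exact E.zero_notMem h1

/-- An element of d(E) lies above some b⁻¹b with b in E, and b⁻¹b is itself in d(E) = E. -/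
theorem exists_idem_le {E : ProperFilter S} (hE : E.dF = E) {x : S} (hx : x ∈ E) :
    ∃ e ∈ E, IsIdempotentElem e ∧ e ≤ x := by
  have hx' : x ∈ E.dF := by rw [hE]; exact hx
  obtain ⟨b, hb, h⟩ := mem_dF.1 hx'
  refine ⟨b⁻¹ * b, ?_, idem_inv_mul b, h⟩
  have : b⁻¹ * b ∈ E.dF := ⟨b, hb, b, hb, le_rfl⟩
  rwa [hE] at this

theorem self_mem_translate {a : S} {E : ProperFilter S} (ha : a⁻¹ * a ∈ E) (hE : E.dF = E) :
    a ∈ translate a E ha hE :=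
  ⟨a⁻¹ * a, ha, (mul_inv_mul' a).le⟩

/-- For an idempotent f in E, (af)⁻¹(af) = (a⁻¹a)f, which lies in E and below f. Idempotents suffice
on both sides by `exists_idem_le`. -/
theorem dF_translate {a : S} {E : ProperFilter S} (ha : a⁻¹ * a ∈ E) (hE : E.dF = E) :
    (translate a E ha hE).dF = E := by
  apply ProperFilter.ext
  ext x
  rw [mem_dF]
  constructor
  · rintro ⟨s, ⟨e, he, h1⟩, h2⟩
    obtain ⟨f, hf, hfi, hfe⟩ := exists_idem_le hE he
    have h3 := mul_inv_mul_mem ha hf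
    rw [inv_idem hfi, hfi.eq] at h3
    refine E.upper h3 (le_trans ?_ h2)
    have h4 : a * f ≤ s := (mul_le_mul_nat le_rfl hfe).trans h1
    refine le_trans (le_of_eq ?_) (mul_le_mul_nat (inv_le_inv' h4) h4)
    calc a⁻¹ * a * f = a⁻¹ * a * (f * f) := by rw [hfi.eq]
      _ = (a⁻¹ * a * f) * f := (mul_assoc _ _ _).symm
      _ = (f * (a⁻¹ * a)) * f := by rw [idem_comm (idem_inv_mul a) hfi]
      _ = (a * f)⁻¹ * (a * f) := by rw [mul_inv_rev', inv_idem hfi]; simp only [mul_assoc]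
  · intro hx
    obtain ⟨e, he, hei, h1⟩ := exists_idem_le hE hx
    refine ⟨a * e, ⟨e, he, le_rfl⟩, le_trans ?_ h1⟩
    rw [mul_inv_rev', inv_idem hei]
    calc e * a⁻¹ * (a * e) = e * ((a⁻¹ * a) * e) := by simp only [mul_assoc]
      _ ≤ e * e := mul_le_mul_nat le_rfl (idem_mul_le e (idem_inv_mul a))
      _ = e := hei.eq

end ProperFilter

/-! ### Basis and compact sets of the universal groupoid -/

namespace UniversalGroupoid

open ProperFilter

variable {S : Type*} [InverseSemigroupWithZero S]

theorem isOpen_basicU {a : S} {F : Finset S} (hF : ∀ x ∈ F, x ≤ a) : IsOpen (basicU a F) :=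
  isOpen_generateFrom_of_mem ⟨a, F, hF, rfl⟩

/-- Each excluded x is replaced by x(c⁻¹c), which lies below c because x and c are both below a. For
filters containing c the two exclusions are equivalent. Two basic sets around A are thereby brought
under the same top element c, where their exclusions can be merged. -/
theorem exists_basicU_subset_inter {A : ProperFilter S} {a c : S} {F : Finset S}
    (hF : ∀ x ∈ F, x ≤ a) (hA : A ∈ basicU a F) (hc : c ∈ A) (hca : c ≤ a) :
    ∃ F' : Finset S, (∀ x ∈ F', x ≤ c) ∧ A ∈ basicU c F' ∧ basicU c F' ⊆ basicU a F := by
  classical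
  refine ⟨F.image fun x => x * (c⁻¹ * c), ?_, ⟨hc, ?_⟩, ?_⟩
  · intro x hx
    obtain ⟨y, hy, rfl⟩ := Finset.mem_image.1 hx
    exact (mul_le_mul_nat (hF y hy) le_rfl).trans (eq_mul_of_le hca).le
  · intro x hx hxA
    obtain ⟨y, hy, rfl⟩ := Finset.mem_image.1 hx
    exact hA.2 y hy (mem_of_mul_inv_mul_mem hxA)
  · rintro B ⟨hcB, hB⟩
    exact ⟨B.upper hcB hca, fun x hx hxB =>
      hB _ (Finset.mem_image_of_mem _ hx) (mul_inv_mul_mem hxB hcB)⟩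

theorem isTopologicalBasis_basicU : IsTopologicalBasis
    {X : Set (UniversalGroupoid S) |
      ∃ (a : S) (F : Finset S), (∀ x ∈ F, x ≤ a) ∧ X = basicU a F} where
  exists_subset_inter := by
    classical
    rintro _ ⟨a, F, hF, rfl⟩ _ ⟨b, F', hF', rfl⟩ A ⟨hA, hA'⟩
    obtain ⟨c, hc, hca, hcb⟩ := A.directed hA.1 hA'.1
    obtain ⟨H, hH, hAH, hs⟩ := exists_basicU_subset_inter hF hA hc hca
    obtain ⟨H', hH', hAH', hs'⟩ := exists_basicU_subset_inter hF' hA' hc hcb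
    refine ⟨_, ⟨c, H ∪ H', ?_, rfl⟩, ⟨hc, ?_⟩, ?_⟩
    · intro x hx
      exact (Finset.mem_union.1 hx).elim (hH x) (hH' x)
    · intro x hx
      exact (Finset.mem_union.1 hx).elim (hAH.2 x) (hAH'.2 x)
    · rintro B ⟨hcB, hB⟩
      exact ⟨hs ⟨hcB, fun x hx => hB x (Finset.mem_union_left _ hx)⟩,
        hs' ⟨hcB, fun x hx => hB x (Finset.mem_union_right _ hx)⟩⟩
  sUnion_eq := by
    refine Set.eq_univ_of_forall fun A => ?_
    obtain ⟨a, ha⟩ := A.nonempty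
    exact ⟨_, ⟨a, ∅, by simp, rfl⟩, ha, by simp⟩
  eq_generateFrom := rfl

/-- An ultrafilter on U_a converges to the filter generated by those x ≤ a for which U_x is a member
of the ultrafilter. -/
theorem isCompact_setOf_mem (a : S) : IsCompact {A : UniversalGroupoid S | a ∈ A} := by
  rw [isCompact_iff_ultrafilter_le_nhds]
  intro 𝒰 h𝒰
  rw [Filter.le_principal_iff] at h𝒰
  have key : ∀ {x y : S}, {A : UniversalGroupoid S | x ∈ A} ∈ 𝒰 → {A | y ∈ A} ∈ 𝒰 →
      {A | x * (y⁻¹ * y) ∈ A} ∈ 𝒰 := fun hx hy =>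
    Filter.mem_of_superset (Filter.inter_mem hx hy) fun A hA => mul_inv_mul_mem hA.1 hA.2
  refine ⟨{
    -- The bound x ≤ a gives directedness: for x, y ≤ a the element x(y⁻¹y) lies below both.
    carrier := {s | ∃ x, x ≤ a ∧ x ≤ s ∧ {A : UniversalGroupoid S | x ∈ A} ∈ 𝒰}
    nonempty := ⟨a, a, le_rfl, le_rfl, h𝒰⟩
    upper := by
      rintro s t ⟨x, hx, hxs, h⟩ hst
      exact ⟨x, hx, hxs.trans hst, h⟩
    directed := by
      rintro s t ⟨x, hx, hxs, h⟩ ⟨y, hy, hyt, h'⟩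
      have h1 : x * (y⁻¹ * y) ≤ x := mul_idem_le x (idem_inv_mul y)
      have h2 : x * (y⁻¹ * y) ≤ y := (mul_le_mul_nat hx le_rfl).trans (eq_mul_of_le hy).le
      exact ⟨_, ⟨_, h1.trans hx, le_rfl, key h h'⟩, h1.trans hxs, h2.trans hyt⟩
    zero_notMem := by
      rintro ⟨x, hx, h0, h⟩
      obtain ⟨A, hA⟩ := 𝒰.nonempty_of_mem h
      exact A.zero_notMem (A.upper hA h0) }, ⟨a, le_rfl, le_rfl, h𝒰⟩, ?_⟩
  rw [nhds_generateFrom]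
  refine le_iInf₂ ?_
  rintro _ ⟨hAU, b, F, hF, rfl⟩
  obtain ⟨⟨x, hxa, hxb, hx⟩, hA⟩ := hAU
  rw [Filter.le_principal_iff]
  -- If U_f were in the ultrafilter, so would be U of f(x⁻¹x). Since f(x⁻¹x) ≤ b(x⁻¹x) = x ≤ a, this
  -- would put f in the limit. The complement of U_f is therefore in the ultrafilter.
  have h1 : ∀ f ∈ F, {A : UniversalGroupoid S | f ∉ A} ∈ 𝒰 := by
    intro f hf
    have h2 : {A : UniversalGroupoid S | f ∈ A} ∉ 𝒰 := by
      intro h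
      refine hA f hf ⟨f * (x⁻¹ * x), ?_, mul_idem_le f (idem_inv_mul x), key h hx⟩
      exact ((mul_le_mul_nat (hF f hf) le_rfl).trans (eq_mul_of_le hxb).le).trans hxa
    exact Ultrafilter.compl_mem_iff_notMem.2 h2
  have h3 : (⋂ f ∈ F, {A : UniversalGroupoid S | f ∉ A}) ∈ (𝒰 : Filter _) :=
    (Filter.biInter_finset_mem F).2 h1
  refine Filter.mem_of_superset (Filter.inter_mem hx h3) ?_
  rintro A ⟨hxA, hA⟩
  exact ⟨A.upper hxA hxb, fun f hf => Set.mem_iInter₂.1 hA f hf⟩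

theorem isOpen_setOf_mem (a : S) : IsOpen {A : UniversalGroupoid S | a ∈ A} := by
  have h := isOpen_basicU (a := a) (F := ∅) (by simp)
  have h' : basicU a ∅ = {A : UniversalGroupoid S | a ∈ A} := by ext; simp [basicU]
  rwa [h'] at h

theorem isCompact_basicU (a : S) (F : Finset S) : IsCompact (basicU a F) := by
  have h : basicU a F =
      {A : UniversalGroupoid S | a ∈ A} \ ⋃ x ∈ F, {A : UniversalGroupoid S | x ∈ A} := by
    ext A
    simp [basicU]
  rw [h]
  exact (isCompact_setOf_mem a).diff (isOpen_biUnion fun x _ => isOpen_setOf_mem x)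

/-! ### Continuity of the operations -/

theorem continuous_inv : Continuous (ArrowGroupoid.inv : UniversalGroupoid S → _) := by
  classical
  refine continuous_generateFrom_iff.2 ?_
  rintro _ ⟨a, F, hF, rfl⟩
  have h : ArrowGroupoid.inv ⁻¹' basicU a F = basicU a⁻¹ (F.image fun x => x⁻¹) := by
    ext A
    change (a⁻¹ ∈ A ∧ ∀ x ∈ F, x⁻¹ ∉ A) ↔ (a⁻¹ ∈ A ∧ _)
    simp
  rw [h]
  apply isOpen_basicU
  simpa using fun x hx => inv_le_inv' (hF x hx)

/-- Near (A, B) with xy ≤ a, x in A and y in B, all exclusions can be put on the second factor. It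
is enough that A' contains x and that B' contains y and avoids the excluded elements divided on the
left by x. -/
theorem continuous_comp : Continuous (fun p : {p : UniversalGroupoid S × UniversalGroupoid S //
    d p.1 = r p.2} => comp p.1.1 p.1.2 p.2) := by
  classical
  refine continuous_generateFrom_iff.2 ?_
  rintro _ ⟨a, F, hF, rfl⟩
  rw [isOpen_iff_mem_nhds]
  rintro ⟨⟨A, B⟩, hAB⟩ ⟨⟨x, hx, y, hy, hxy⟩, hfA⟩
  have hAB' : A.dF = B.rF := hAB
  have hle : ∀ f ∈ F, f * ((x * y)⁻¹ * (x * y)) ≤ x * y := fun f hf =>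
    (mul_le_mul_nat (hF f hf) le_rfl).trans (eq_mul_of_le hxy).le
  -- Restricting f to the domain of xy brings it below xy. Multiplying by x⁻¹ then brings it below
  -- y, as a basic set with top y requires.
  set F' := F.image fun f => x⁻¹ * (f * ((x * y)⁻¹ * (x * y)))
  have h1 : IsOpen (basicU y F') := by
    apply isOpen_basicU
    intro z hz
    obtain ⟨f, hf, rfl⟩ := Finset.mem_image.1 hz
    exact (mul_le_mul_nat le_rfl (hle f hf)).trans (inv_mul_le x y)
  have h2 : B ∈ basicU y F' := by
    refine ⟨hy, fun z hz hzB => ?_⟩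
    obtain ⟨f, hf, rfl⟩ := Finset.mem_image.1 hz
    exact hfA f hf ⟨x, hx, _, hzB,
      (mul_inv_le x _).trans (mul_idem_le f (idem_inv_mul (x * y)))⟩
  have h3 : ({A : UniversalGroupoid S | x ∈ A} ×ˢ basicU y F') ∈ nhds (A, B) :=
    ((isOpen_setOf_mem x).prod h1).mem_nhds ⟨hx, h2⟩
  refine Filter.mem_of_superset (continuous_subtype_val.continuousAt.preimage_mem_nhds h3) ?_
  rintro ⟨⟨A', B'⟩, hAB₁⟩ ⟨hx', hy', hB'⟩
  have hd : A'.dF = B'.rF := hAB₁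
  have hc : x * y ∈ A'.compF B' hd := ⟨x, hx', y, hy', le_rfl⟩
  refine ⟨(A'.compF B' hd).upper hc hxy, fun f hf hfC => ?_⟩
  obtain ⟨u, hu, v, hv, huv⟩ :=
    (mul_inv_mul_mem (A := A'.compF B' hd) hfC hc : f * ((x * y)⁻¹ * (x * y)) ∈ A'.compF B' hd)
  -- With w below both u and x, the element w⁻¹(wv) stays in B' and lies below x⁻¹ times the
  -- restricted f, which B' was chosen to avoid.
  obtain ⟨w, hw, hwu, hwx⟩ := A'.directed hu hx'
  refine hB' _ (Finset.mem_image_of_mem _ hf) (B'.upper (restrict_right hd hw hv) ?_)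
  exact mul_le_mul_nat (inv_le_inv' hwx) ((mul_le_mul_nat hwu le_rfl).trans huv)

/-! ### The domain map is a local homeomorphism -/

theorem continuous_d : Continuous (d : UniversalGroupoid S → _) := by
  have h := continuous_comp.comp
    ((continuous_inv.prodMk continuous_id).subtype_mk
      (fun A : UniversalGroupoid S => (d_inv A : d (inv A) = r A)))
  refine h.congr fun A => inv_comp A _

/-- The domain map into the space of identities. -/
def dom (A : UniversalGroupoid S) : Identities (UniversalGroupoid S) :=
  ⟨d A, by rw [← r_d A, d_r]⟩

theorem continuous_dom : Continuous (dom (S := S)) :=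
  continuous_d.subtype_mk _

/-- If a⁻¹x is in d(A), then a(a⁻¹x) is in A·d(A) = A and lies below x, so x is in A. In the other
direction the preimage of E is (aE)↑: if it contained x, its domain E would contain a⁻¹x. -/
theorem dom_image_basicU (a : S) (F : Finset S) :
    dom '' basicU a F = {E | a⁻¹ * a ∈ E.1 ∧ ∀ x ∈ F, a⁻¹ * x ∉ E.1} := by
  ext E
  constructor
  · rintro ⟨A, ⟨ha, hA⟩, rfl⟩
    refine ⟨⟨a, ha, a, ha, le_rfl⟩, fun x hx hxA => hA x hx ?_⟩
    have hc : a * (a⁻¹ * x) ∈ A.compF A.dF (rF_dF A).symm := ⟨a, ha, _, hxA, le_rfl⟩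
    have e : A.compF A.dF (rF_dF A).symm = A := comp_d A _
    rw [e] at hc
    exact A.upper hc (mul_inv_le a x)
  · rintro ⟨ha, hE⟩
    refine ⟨translate a E.1 ha E.2, ⟨self_mem_translate ha E.2, fun x hx hxA => hE x hx ?_⟩,
      Subtype.ext (dF_translate ha E.2)⟩
    rw [← dF_translate ha E.2]
    exact ⟨a, self_mem_translate ha E.2, x, hxA, le_rfl⟩

theorem isOpen_dom_image_basicU {a : S} {F : Finset S} (hF : ∀ x ∈ F, x ≤ a) :
    IsOpen (dom '' basicU a F) := by
  classical
  have h : dom '' basicU a F = Subtype.val ⁻¹' basicU (a⁻¹ * a) (F.image fun x => a⁻¹ * x) := by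
    rw [dom_image_basicU]
    ext E
    simp [basicU]
  rw [h]
  refine (isOpen_basicU ?_).preimage continuous_subtype_val
  simpa using fun x hx => mul_le_mul_nat le_rfl (hF x hx)

theorem isOpenMap_dom : IsOpenMap (dom (S := S)) := by
  rw [isTopologicalBasis_basicU.isOpenMap_iff]
  rintro _ ⟨a, F, hF, rfl⟩
  exact isOpen_dom_image_basicU hF

theorem isLocalHomeomorph_dom : IsLocalHomeomorph (dom (S := S)) := by
  rw [isLocalHomeomorph_iff_isOpenEmbedding_restrict]
  intro A
  obtain ⟨a, ha⟩ := A.nonempty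
  refine ⟨{A | a ∈ A}, (isOpen_setOf_mem a).mem_nhds ha,
    .of_continuous_injective_isOpenMap (continuous_dom.comp continuous_subtype_val) ?_
      (isOpenMap_dom.comp (isOpen_setOf_mem a).isOpenMap_subtype_val)⟩
  rintro ⟨B, hB⟩ ⟨C, hC⟩ h
  exact Subtype.ext (eq_of_dF_eq hB hC (congrArg Subtype.val h))

/-! ### The space of identities -/

instance t2Space_identities : T2Space (Identities (UniversalGroupoid S)) := by
  classical
  -- Take an idempotent e ≤ x in E and any idempotent f in F. Then U_e and U_{f;fe} separate E from
  -- F, because a filter containing both e and f contains fe.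
  have key : ∀ E F : Identities (UniversalGroupoid S), ∀ x : S, x ∈ E.1 → x ∉ F.1 →
      ∃ u v : Set (Identities (UniversalGroupoid S)),
        IsOpen u ∧ IsOpen v ∧ E ∈ u ∧ F ∈ v ∧ Disjoint u v := by
    intro E F x hxE hxF
    obtain ⟨e, he, hei, hex⟩ := exists_idem_le E.2 hxE
    have heF : e ∉ F.1 := fun h => hxF (F.1.upper h hex)
    obtain ⟨f, hf⟩ := F.1.nonempty
    obtain ⟨f, hf, hfi, -⟩ := exists_idem_le F.2 hf
    refine ⟨Subtype.val ⁻¹' {A | e ∈ A}, Subtype.val ⁻¹' basicU f {f * e},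
      (isOpen_setOf_mem e).preimage continuous_subtype_val,
      (isOpen_basicU ?_).preimage continuous_subtype_val, he, ⟨hf, ?_⟩, ?_⟩
    · simpa using mul_idem_le f hei
    · intro z hz hzF
      obtain rfl := Finset.mem_singleton.1 hz
      exact heF (F.1.upper hzF (idem_mul_le e hfi))
    · rw [Set.disjoint_left]
      rintro G hG ⟨hfG, hG'⟩
      refine hG' (f * e) (by simp) ?_
      have h := mul_inv_mul_mem hfG hG
      rwa [inv_idem hei, hei.eq] at h
  refine ⟨fun E F hEF => ?_⟩
  -- One filter may contain the other, so a separating element may exist on one side only.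
  by_cases h : ∃ x, x ∈ E.1 ∧ x ∉ F.1
  · obtain ⟨x, h1, h2⟩ := h
    exact key E F x h1 h2
  · by_cases h' : ∃ x, x ∈ F.1 ∧ x ∉ E.1
    · obtain ⟨x, h1, h2⟩ := h'
      obtain ⟨u, v, hu, hv, h3, h4, h5⟩ := key F E x h1 h2
      exact ⟨v, u, hv, hu, h4, h3, h5.symm⟩
    · push Not at h h'
      exact (hEF (Subtype.ext (SetLike.ext fun x => ⟨h x, h' x⟩))).elim

/-- The map `dom` fixes identities, so a basic set around E inside the preimage of O has an image
that is compact, open, inside O and contains E. This gives local compactness and, with the Hausdorff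
property, zero-dimensionality. -/
theorem exists_isCompact_isOpen_subset {E : Identities (UniversalGroupoid S)}
    {O : Set (Identities (UniversalGroupoid S))} (hE : E ∈ O) (hO : IsOpen O) :
    ∃ V, IsCompact V ∧ IsOpen V ∧ E ∈ V ∧ V ⊆ O := by
  have hdE : dom E.1 = E := Subtype.ext E.2
  obtain ⟨_, ⟨a, F, hF, rfl⟩, hEU, hU⟩ := isTopologicalBasis_basicU.exists_subset_of_mem_open
    (show E.1 ∈ dom ⁻¹' O by change dom E.1 ∈ O; rwa [hdE]) (hO.preimage continuous_dom)
  exact ⟨dom '' basicU a F, (isCompact_basicU a F).image continuous_dom,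
    isOpen_dom_image_basicU hF, ⟨E.1, hEU, hdE⟩, Set.image_subset_iff.2 hU⟩

theorem isBooleanGroupoid : IsBooleanGroupoid (UniversalGroupoid S) where
  continuous_inv := continuous_inv
  continuous_comp := continuous_comp
  etale := isLocalHomeomorph_dom
  t2 := t2Space_identities
  locallyCompact := by
    have : WeaklyLocallyCompactSpace (Identities (UniversalGroupoid S)) := ⟨fun E => by
      obtain ⟨V, hV, hVo, hE, -⟩ :=
        exists_isCompact_isOpen_subset (Set.mem_univ E) isOpen_univ
      exact ⟨V, hV, hVo.mem_nhds hE⟩⟩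
    infer_instance
  zeroDim := by
    refine isTopologicalBasis_of_isOpen_of_nhds (fun U hU => hU.isOpen) fun E O hE hO => ?_
    obtain ⟨V, hV, hVo, hEV, hVO⟩ := exists_isCompact_isOpen_subset hE hO
    exact ⟨V, ⟨hV.isClosed, hVo⟩, hEV, hVO⟩

end UniversalGroupoid

end InvSgp

/-! ### The bijection Φ between proper filters of S and prime filters of D(S) -/

namespace InvSgp

open InverseSemigroupWithZero ArrowGroupoid TopologicalSpace

namespace DistributiveCompletion

variable {S : Type*} [InverseSemigroupWithZero S]

theorem principal_le {a : S} {A : DistributiveCompletion S} : principal a ≤ A ↔ a ∈ A := by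
  rw [le_iff_subset]
  exact ⟨fun h => h (le_refl a), fun h x hx => A.lower h hx⟩

/-- The order ideal generated by finitely many elements below a common element. -/
def ofBounded (a : S) (F : Finset S) (hF : ∀ x ∈ F, x ≤ a) : DistributiveCompletion S where
  -- The 0 keeps the generating set nonempty when F is empty; it adds no elements otherwise.
  carrier := {s | ∃ x ∈ insert 0 (F : Set S), s ≤ x}
  fg := by
    have h : ∀ x ∈ insert 0 (F : Set S), x ≤ a := by
      rintro x (rfl | hx)
      · exact zero_le' a
      · exact hF x hx
    exact ⟨_, F.finite_toSet.insert 0, Set.insert_nonempty _ _,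
      fun x hx y hy => (Compatible.refl a).mono (h x hx) (h y hy), rfl⟩

theorem ofBounded_le_principal {a : S} {F : Finset S} (hF : ∀ x ∈ F, x ≤ a) :
    ofBounded a F hF ≤ principal a := by
  rw [le_iff_subset]
  rintro s ⟨x, rfl | hx, hs⟩
  · exact hs.trans (zero_le' a)
  · exact hs.trans (hF x hx)

/-- The map `Φ`: the prime filter of elements of the completion that meet a proper filter. -/
def filterToPrime (F : ProperFilter S) : PrimeFilter (DistributiveCompletion S) where
  carrier := {A | ((A : Set S) ∩ (F : Set S)).Nonempty}
  nonempty := by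
    obtain ⟨a, ha⟩ := F.nonempty
    exact ⟨principal a, a, le_refl a, ha⟩
  upper := by
    rintro A B ⟨a, haA, haF⟩ h
    exact ⟨a, le_iff_subset.1 h haA, haF⟩
  directed := by
    rintro A B ⟨a, haA, haF⟩ ⟨b, hbB, hbF⟩
    obtain ⟨c, hc, hca, hcb⟩ := F.directed haF hbF
    exact ⟨principal c, ⟨c, le_refl c, hc⟩, principal_le.2 (A.lower haA hca),
      principal_le.2 (B.lower hbB hcb)⟩
  zero_notMem := by
    rintro ⟨a, ha, haF⟩
    exact F.zero_notMem (F.upper haF ha)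
  prime := by
    rintro A B C hAB hC ⟨c, hc, hcF⟩
    -- Joins in the completion are unions, so primeness holds for every proper filter F.
    have hc' : c ∈ A.carrier ∪ B.carrier := union_of_isLUB hAB hC ▸ hc
    exact hc'.imp (fun h => ⟨c, h, hcF⟩) (fun h => ⟨c, h, hcF⟩)

theorem mem_filterToPrime {F : ProperFilter S} {A : DistributiveCompletion S} :
    A ∈ filterToPrime F ↔ ∃ a ∈ A.carrier, a ∈ F := Iff.rfl

theorem principal_mem_filterToPrime {F : ProperFilter S} {a : S} :
    principal a ∈ filterToPrime F ↔ a ∈ F :=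
  ⟨fun ⟨_, hx, hxF⟩ => F.upper hxF hx, fun h => ⟨a, le_refl a, h⟩⟩

/-- The ideal is a finite join of principal ideals, and primeness, applied to one generator at a
time, selects one that lies in P. This is what makes Φ surjective. -/
theorem exists_principal_mem (P : PrimeFilter (DistributiveCompletion S))
    {A : DistributiveCompletion S} (hA : A ∈ P) : ∃ a ∈ A.carrier, principal a ∈ P := by
  obtain ⟨F, hF, -, hc, hAF⟩ := A.fg
  have key : ∀ F : Set S, F.Finite → (∀ a ∈ F, ∀ b ∈ F, Compatible a b) →
      ∀ A : DistributiveCompletion S, A.carrier = {s | ∃ a ∈ F, s ≤ a} → A ∈ P →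
      ∃ a ∈ F, principal a ∈ P := by
    intro F hF
    induction F, hF using Set.Finite.induction_on with
    | empty =>
      intro _ A hA _
      have h0 := A.zero_mem
      rw [hA] at h0
      obtain ⟨a, ha, -⟩ := h0
      exact ha.elim
    | @insert a F _ hF ih =>
      intro hc A hA hAP
      -- The remaining generators define an element of the completion only when there are some.
      rcases F.eq_empty_or_nonempty with rfl | hn
      · refine ⟨a, by simp, ?_⟩
        have : A = principal a := DistributiveCompletion.ext (by rw [hA]; ext; simp [principal])
        rwa [← this]
      · have hcF : ∀ x ∈ F, ∀ y ∈ F, Compatible x y := fun x hx y hy =>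
          hc x (Or.inr hx) y (Or.inr hy)
        let B : DistributiveCompletion S := ⟨_, F, hF, hn, hcF, rfl⟩
        have hu : A.carrier = (principal a).carrier ∪ B.carrier := by
          rw [hA]
          ext x
          simp [B, principal]
        have h1 : principal a ≤ A := le_iff_subset.2 (hu ▸ Set.subset_union_left)
        have h2 : B ≤ A := le_iff_subset.2 (hu ▸ Set.subset_union_right)
        rcases P.prime ((Compatible.refl A).mono h1 h2) (isLUB_of_union hu) hAP with h | h
        · exact ⟨a, by simp, h⟩
        · obtain ⟨b, hb, h'⟩ := ih hcF B rfl h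
          exact ⟨b, Or.inr hb, h'⟩
  obtain ⟨a, ha, h⟩ := key F hF hc A hAF hA
  exact ⟨a, by rw [hAF]; exact ⟨a, ha, le_rfl⟩, h⟩

/-- The inverse of `Φ`. -/
def primeToFilter (P : PrimeFilter (DistributiveCompletion S)) : ProperFilter S where
  carrier := {a | principal a ∈ P}
  nonempty := by
    obtain ⟨A, hA⟩ := P.nonempty
    obtain ⟨a, -, ha⟩ := exists_principal_mem P hA
    exact ⟨a, ha⟩
  upper h h' := P.upper h (principal_le.2 h')
  directed h h' := by
    -- The common lower bound C need not be principal; a principal ideal of P inside it supplies the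
    -- element of S.
    obtain ⟨C, hC, h1, h2⟩ := P.directed h h'
    obtain ⟨c, hc, hcP⟩ := exists_principal_mem P hC
    exact ⟨c, hcP, le_iff_subset.1 h1 hc, le_iff_subset.1 h2 hc⟩
  zero_notMem h := P.zero_notMem h

/-- `Φ` as a bijection. -/
def filterEquiv : UniversalGroupoid S ≃ PrimeFilter (DistributiveCompletion S) where
  toFun := filterToPrime
  invFun := primeToFilter
  left_inv _ := SetLike.ext fun _ => principal_mem_filterToPrime
  right_inv P := SetLike.ext fun _ =>
    (mem_filterToPrime (F := primeToFilter P)).trans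
      ⟨fun ⟨_, ha, haP⟩ => P.upper haP (principal_le.2 ha), fun h => exists_principal_mem P h⟩

/-! ### Φ is a homeomorphism -/

theorem preimage_basicV_ofBounded {a : S} {F : Finset S} (hF : ∀ x ∈ F, x ≤ a) :
    filterToPrime ⁻¹' (basicV (principal a) (ofBounded a F hF) : Set (PrimeFilter _)) =
      basicU a F := by
  ext A
  change (principal a ∈ filterToPrime A ∧ ofBounded a F hF ∉ filterToPrime A) ↔ (a ∈ A ∧ _)
  rw [principal_mem_filterToPrime]
  refine and_congr_right fun _ => ⟨fun h x hx hxA => h ⟨x, ⟨x, Or.inr hx, le_rfl⟩, hxA⟩, ?_⟩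
  rintro h ⟨x, ⟨y, rfl | hy, hxy⟩, hxA⟩
  · exact A.zero_notMem (A.upper hxA hxy)
  · exact h y hy (A.upper hxA hxy)

/-- Filters are upward closed, so a filter meeting an ideal contains one of its generators. -/
theorem preimage_setOf_mem (A : DistributiveCompletion S) :
    ∃ F : Set S, F.Finite ∧
      filterToPrime ⁻¹' {P | A ∈ P} = ⋃ a ∈ F, {G : UniversalGroupoid S | a ∈ G} := by
  obtain ⟨F, hF, -, -, hA⟩ := A.fg
  refine ⟨F, hF, ?_⟩
  ext G
  simp only [Set.mem_preimage, Set.mem_ofPred_eq, Set.mem_iUnion, exists_prop, mem_filterToPrime,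
    hA]
  exact ⟨fun ⟨x, ⟨a, ha, h⟩, hx⟩ => ⟨a, ha, G.upper hx h⟩,
    fun ⟨a, ha, h⟩ => ⟨a, ⟨a, ha, le_rfl⟩, h⟩⟩

theorem isOpen_preimage_setOf_mem (A : DistributiveCompletion S) :
    IsOpen (filterToPrime ⁻¹' {P | A ∈ P}) := by
  obtain ⟨F, -, h⟩ := preimage_setOf_mem A
  rw [h]
  exact isOpen_biUnion fun a _ => UniversalGroupoid.isOpen_setOf_mem a

theorem isCompact_preimage_basicV (A B : DistributiveCompletion S) :
    IsCompact (filterToPrime ⁻¹' (basicV A B : Set (PrimeFilter (DistributiveCompletion S)))) := by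
  have h : filterToPrime ⁻¹' (basicV A B : Set (PrimeFilter _)) =
      filterToPrime ⁻¹' {P | A ∈ P} \ filterToPrime ⁻¹' {P | B ∈ P} := rfl
  rw [h]
  refine IsCompact.diff ?_ (isOpen_preimage_setOf_mem B)
  obtain ⟨F, hF, h⟩ := preimage_setOf_mem A
  rw [h]
  exact hF.isCompact_biUnion fun a _ => UniversalGroupoid.isCompact_setOf_mem a

/-- Around G choose a in A ∩ G and exclude x(a⁻¹a) for the finitely many generators x of B. Among
filters containing a, this is the same as excluding every element of B. -/
theorem isOpen_preimage_basicV {A B : DistributiveCompletion S} (hBA : B ≤ A) :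
    IsOpen (filterToPrime ⁻¹' (basicV A B : Set (PrimeFilter (DistributiveCompletion S)))) := by
  classical
  rw [isOpen_iff_mem_nhds]
  rintro G ⟨⟨a, haA, haG⟩, hGB⟩
  obtain ⟨F, hF, -, -, hB⟩ := B.fg
  have hFB : ∀ x ∈ F, x ∈ B.carrier := fun x hx => by rw [hB]; exact ⟨x, hx, le_rfl⟩
  refine Filter.mem_of_superset ((UniversalGroupoid.isOpen_basicU
    (F := hF.toFinset.image fun x => x * (a⁻¹ * a)) ?_).mem_nhds ⟨haG, ?_⟩) ?_
  · intro z hz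
    obtain ⟨x, hx, rfl⟩ := Finset.mem_image.1 hz
    -- Both x and a lie in A because B ≤ A. They are thus compatible, xa⁻¹ is idempotent, and
    -- (xa⁻¹)a ≤ a.
    have h := (A.compatible (le_iff_subset.1 hBA (hFB x (hF.mem_toFinset.1 hx))) haA).2
    rw [← mul_assoc]
    exact idem_mul_le a h
  · intro z hz hzG
    obtain ⟨x, hx, rfl⟩ := Finset.mem_image.1 hz
    exact hGB ⟨x, hFB x (hF.mem_toFinset.1 hx), ProperFilter.mem_of_mul_inv_mul_mem hzG⟩
  · rintro G' ⟨ha, hG'⟩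
    refine ⟨⟨a, haA, ha⟩, ?_⟩
    rintro ⟨b, hb, hbG⟩
    have hb' : b ∈ B.carrier := hb
    rw [hB] at hb'
    obtain ⟨x, hx, hbx⟩ := hb'
    exact hG' _ (Finset.mem_image_of_mem _ (hF.mem_toFinset.2 hx))
      (ProperFilter.mul_inv_mul_mem (G'.upper hbG hbx) ha)

/-- `Φ` as a homeomorphism. -/
def filterHomeomorph : UniversalGroupoid S ≃ₜ PrimeFilter (DistributiveCompletion S) where
  toEquiv := filterEquiv
  continuous_toFun := by
    refine continuous_generateFrom_iff.2 ?_
    rintro _ ⟨A, B, hBA, rfl⟩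
    exact isOpen_preimage_basicV hBA
  continuous_invFun := by
    refine continuous_generateFrom_iff.2 ?_
    rintro _ ⟨a, F, hF, rfl⟩
    have h : filterEquiv.symm ⁻¹' basicU a F =
        (basicV (principal a) (ofBounded a F hF) : Set (PrimeFilter _)) := by
      rw [← preimage_basicV_ofBounded hF]
      exact filterEquiv.symm_preimage_preimage _
    exact isOpen_generateFrom_of_mem ⟨_, _, ofBounded_le_principal hF, h⟩

/-! ### Φ is a functor -/

theorem filterToPrime_d (F : ProperFilter S) : filterToPrime (d F) = d (filterToPrime F) := by
  ext A
  constructor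
  · rintro ⟨s, hs, b, hb, c, hc, h⟩
    refine ⟨principal b, principal_mem_filterToPrime.2 hb, principal c,
      principal_mem_filterToPrime.2 hc, le_iff_subset.2 ?_⟩
    rintro _ ⟨x, hx, y, hy, rfl⟩
    refine A.lower hs ((mul_le_mul_nat ?_ hy).trans h)
    exact inv_le_iff.1 hx
  · rintro ⟨B, ⟨b, hb, hbF⟩, C, ⟨c, hc, hcF⟩, h⟩
    exact ⟨b⁻¹ * c, le_iff_subset.1 h ⟨b⁻¹, by rw [mem_inv, inv_inv']; exact hb, c, hc, rfl⟩,
      b, hbF, c, hcF, le_rfl⟩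

theorem filterToPrime_r (F : ProperFilter S) : filterToPrime (r F) = r (filterToPrime F) := by
  ext A
  constructor
  · rintro ⟨s, hs, b, hb, c, hc, h⟩
    refine ⟨principal b, principal_mem_filterToPrime.2 hb, principal c,
      principal_mem_filterToPrime.2 hc, le_iff_subset.2 ?_⟩
    rintro _ ⟨x, hx, y, hy, rfl⟩
    refine A.lower hs ((mul_le_mul_nat hx ?_).trans h)
    exact inv_le_iff.1 hy
  · rintro ⟨B, ⟨b, hb, hbF⟩, C, ⟨c, hc, hcF⟩, h⟩
    exact ⟨b * c⁻¹, le_iff_subset.1 h ⟨b, hb, c⁻¹, by rw [mem_inv, inv_inv']; exact hc, rfl⟩,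
      b, hbF, c, hcF, le_rfl⟩

/-- An element bc of a product of filters is represented by the principal ideals of b and c, whose
product lies below bc. Conversely, elements chosen from two ideals multiply into the product of the
ideals. -/
theorem isFunctor_filterToPrime : IsFunctor (filterToPrime (S := S)) := by
  refine ⟨filterToPrime_d, filterToPrime_r, fun F G h => ?_⟩
  refine ⟨by rw [← filterToPrime_d, ← filterToPrime_r, h], ?_⟩
  ext A
  constructor
  · rintro ⟨s, hs, b, hb, c, hc, h⟩
    refine ⟨principal b, principal_mem_filterToPrime.2 hb, principal c,
      principal_mem_filterToPrime.2 hc, le_iff_subset.2 ?_⟩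
    rintro _ ⟨x, hx, y, hy, rfl⟩
    exact A.lower hs ((mul_le_mul_nat hx hy).trans h)
  · rintro ⟨B, ⟨b, hb, hbF⟩, C, ⟨c, hc, hcF⟩, h⟩
    exact ⟨b * c, le_iff_subset.1 h ⟨b, hb, c, hc, rfl⟩, b, hbF, c, hcF, le_rfl⟩

end DistributiveCompletion

end InvSgp

/-! ### Order, idempotents and joins of partial bisections -/

namespace InvSgp

open InverseSemigroupWithZero ArrowGroupoid TopologicalSpace

/-- The intrinsic order of K asks for an idempotent lying in K; x⁻¹x always serves, since x ≤ y
gives x = y(x⁻¹x). -/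
theorem InverseSubsemigroup.le_iff {T : Type*} [InverseSemigroupWithZero T]
    {K : InverseSubsemigroup T} {x y : K} : naturalOrder.le x y ↔ (x : T) ≤ y := by
  constructor
  · rintro ⟨e, he, rfl⟩
    exact ⟨e, congrArg Subtype.val he, rfl⟩
  · intro h
    exact ⟨x⁻¹ * x, idem_inv_mul x, Subtype.ext (eq_mul_of_le h).symm⟩

theorem InverseSubsemigroup.isIdempotentElem_iff {T : Type*} [InverseSemigroupWithZero T]
    {K : InverseSubsemigroup T} {x : K} : IsIdempotentElem x ↔ IsIdempotentElem (x : T) :=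
  ⟨fun h => congrArg Subtype.val h, fun h => Subtype.ext h⟩

theorem InverseSubsemigroup.compatible_iff {T : Type*} [InverseSemigroupWithZero T]
    {K : InverseSubsemigroup T} {x y : K} : Compatible x y ↔ Compatible (x : T) y :=
  and_congr isIdempotentElem_iff isIdempotentElem_iff

theorem map_inv_of_mulEquiv {T T' : Type*} [InverseSemigroupWithZero T]
    [InverseSemigroupWithZero T'] (f : T ≃* T') (a : T) : f a⁻¹ = (f a)⁻¹ :=
  inv_unique _ _ (by rw [← map_mul, ← map_mul, mul_inv_mul])
    (by rw [← map_mul, ← map_mul, inv_mul_inv])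

namespace PartialBisection

variable {G H : Type*} [ArrowGroupoid G] [ArrowGroupoid H]

/-- If XX = X, a factorization z = xy within X forces z = y by injectivity of d and z = x by
injectivity of r. Then zz = z, so z is an identity. -/
theorem isIdempotentElem_iff {X : PartialBisection G} :
    IsIdempotentElem X ↔ ∀ x ∈ X.carrier, d x = x := by
  constructor
  · intro h z hz
    have hz' : z ∈ (X * X).carrier := by rw [h.eq]; exact hz
    obtain ⟨x, hx, y, hy, k, e⟩ := hz'
    have e1 : z = y := X.d_inj hz hy (by rw [e, d_comp])
    have e2 : z = x := X.r_inj hz hx (by rw [e, r_comp])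
    subst e1
    subst e2
    have e3 := inv_comp_cancel z z k (by rw [d_inv, r_comp])
    rw [comp_congr rfl e.symm, inv_comp] at e3
    exact e3
  · intro h
    apply PartialBisection.ext
    ext z
    constructor
    · rintro ⟨x, hx, y, hy, k, rfl⟩
      have e : comp x y k = x := by
        have h1 : y = d x := by rw [k, ← h y hy, r_d]
        rw [comp_congr rfl h1, comp_d]
      rwa [e]
    · intro hz
      have k : d z = r z := by
        have e := r_d z
        rw [h z hz] at e ⊢
        exact e.symm
      exact ⟨z, hz, z, hz, k, by rw [comp_congr rfl (h z hz).symm, comp_d]⟩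

theorem le_iff_subset {X Y : PartialBisection G} : X ≤ Y ↔ X.carrier ⊆ Y.carrier := by
  constructor
  · rintro ⟨E, hE, rfl⟩ _ ⟨x, hx, e, he, k, rfl⟩
    have h1 : e = d x := by rw [k, ← isIdempotentElem_iff.1 hE e he, r_d]
    rw [comp_congr rfl h1, comp_d]
    exact hx
  · intro h
    have hc := (compatible_of_subset h (Set.Subset.refl Y.carrier)).symm
    refine ⟨X⁻¹ * X, idem_inv_mul X, PartialBisection.ext (Set.Subset.antisymm ?_ ?_)⟩
    · intro w hw
      have hwX : w ∈ (X * (X⁻¹ * X)).carrier := by rw [mul_inv_mul']; exact hw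
      obtain ⟨x, hx, e, he, k, rfl⟩ := hwX
      exact ⟨x, h hx, e, he, k, rfl⟩
    -- X and Y are compatible because both lie in Y. Hence YX⁻¹ consists of identities, and (YX⁻¹)X
    -- adds nothing to X.
    · rw [← mul_assoc]
      rintro _ ⟨e, he, x, hx, k, rfl⟩
      have hid : IsIdempotentElem (Y * X⁻¹) := hc.2
      have h1 : e = r x := by rw [← k, isIdempotentElem_iff.1 hid e he]
      rw [comp_congr h1 rfl, r_comp_self]
      exact hx

/-- The union of two compatible partial bisections. -/
def union (X Y : PartialBisection G) (h : Compatible X Y) : PartialBisection G where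
  carrier := X.carrier ∪ Y.carrier
  d_inj := by
    -- When d(x) = d(y), the product xy⁻¹ is defined and lies in XY⁻¹. Compatibility makes it an
    -- identity, so x = y.
    have key : ∀ x ∈ X.carrier, ∀ y ∈ Y.carrier, d x = d y → x = y := by
      intro x hx y hy e
      have k : d x = r (inv y) := by rw [r_inv, e]
      have h1 := isIdempotentElem_iff.1 h.2 (comp x (inv y) k)
        ⟨x, hx, inv y, by change inv (inv y) ∈ Y.carrier; rwa [ArrowGroupoid.inv_inv], k, rfl⟩
      rw [d_comp, d_inv] at h1
      have h2 := comp_inv_cancel x (inv y) k (by rw [r_inv, d_comp])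
      rw [comp_congr h1.symm (ArrowGroupoid.inv_inv y), r_comp_self] at h2
      exact h2.symm
    rintro x (hx | hx) y (hy | hy) e
    · exact X.d_inj hx hy e
    · exact key x hx y hy e
    · exact (key y hy x hx e.symm).symm
    · exact Y.d_inj hx hy e
  r_inj := by
    -- The dual argument, with x⁻¹y in X⁻¹Y.
    have key : ∀ x ∈ X.carrier, ∀ y ∈ Y.carrier, r x = r y → x = y := by
      intro x hx y hy e
      have k : d (inv x) = r y := by rw [d_inv, e]
      have h1 := isIdempotentElem_iff.1 h.1 (comp (inv x) y k)
        ⟨inv x, by change inv (inv x) ∈ X.carrier; rwa [ArrowGroupoid.inv_inv], y, hy, k, rfl⟩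
      have h3 : comp (inv x) y k = d x := by
        rw [← r_inv x, ← r_comp (inv x) y k, ← h1, r_d]
      have h2 := inv_comp_cancel (inv x) y k (by rw [d_inv, r_comp])
      rw [comp_congr (ArrowGroupoid.inv_inv x) h3, comp_d] at h2
      exact h2
    rintro x (hx | hx) y (hy | hy) e
    · exact X.r_inj hx hy e
    · exact key x hx y hy e
    · exact (key y hy x hx e.symm).symm
    · exact Y.r_inj hx hy e

/-- Pulling back partial bisections along an isomorphism of groupoids. -/
def comap (f : G ≃ H) (hf : IsFunctor f) : PartialBisection H ≃* PartialBisection G where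
  toFun X :=
    { carrier := f ⁻¹' X.carrier
      d_inj := fun x hx y hy e => f.injective (X.d_inj hx hy (by rw [← hf.1, ← hf.1, e]))
      r_inj := fun x hx y hy e => f.injective (X.r_inj hx hy (by rw [← hf.2.1, ← hf.2.1, e])) }
  invFun Y :=
    { carrier := f.symm ⁻¹' Y.carrier
      d_inj := fun x hx y hy e => f.symm.injective (Y.d_inj hx hy (f.injective (by
        rw [hf.1, hf.1, f.apply_symm_apply, f.apply_symm_apply, e])))
      r_inj := fun x hx y hy e => f.symm.injective (Y.r_inj hx hy (f.injective (by
        rw [hf.2.1, hf.2.1, f.apply_symm_apply, f.apply_symm_apply, e]))) }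
  left_inv X := PartialBisection.ext (f.symm_preimage_preimage X.carrier)
  right_inv Y := PartialBisection.ext (f.preimage_symm_preimage Y.carrier)
  map_mul' X Y := by
    apply PartialBisection.ext
    ext z
    constructor
    · rintro ⟨u, hu, v, hv, k, e⟩
      obtain ⟨x, rfl⟩ := f.surjective u
      obtain ⟨y, rfl⟩ := f.surjective v
      have k' : d x = r y := f.injective (by rw [hf.1, hf.2.1, k])
      obtain ⟨k'', e'⟩ := hf.2.2 x y k'
      exact ⟨x, hu, y, hv, k', f.injective (e.trans e'.symm)⟩
    · rintro ⟨x, hx, y, hy, k, rfl⟩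
      obtain ⟨k', e⟩ := hf.2.2 x y k
      exact ⟨f x, hx, f y, hy, k', e⟩

end PartialBisection

theorem isFunctor_filterEquiv {S : Type*} [InverseSemigroupWithZero S] :
    IsFunctor (DistributiveCompletion.filterEquiv (S := S)) :=
  DistributiveCompletion.isFunctor_filterToPrime

/-! ### Compact-open partial bisections and the Booleanization -/

namespace UniversalGroupoid

open DistributiveCompletion

variable {S : Type*} [InverseSemigroupWithZero S]

/-- A compact-open set is a finite union of basic sets U_{a;F} inside it, and each of these is the
pullback of some V_{s;t}. Conversely, pullbacks of the V_{s;t} with t ≤ s are compact and open, and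
both properties survive finite unions. -/
theorem comap_mem_KB_iff {X : PartialBisection (PrimeFilter (DistributiveCompletion S))} :
    PartialBisection.comap filterEquiv isFunctor_filterEquiv X ∈ KB (UniversalGroupoid S) ↔
      X ∈ Booleanization S := by
  constructor
  · rintro ⟨hc, ho⟩
    change IsCompact (filterToPrime ⁻¹' X.carrier) at hc
    change IsOpen (filterToPrime ⁻¹' X.carrier) at ho
    have h1 : ∀ A ∈ filterToPrime ⁻¹' X.carrier,
        ∃ Y : PartialBisection (PrimeFilter (DistributiveCompletion S)),
          (∃ s t, t ≤ s ∧ Y = basicV s t) ∧ A ∈ filterToPrime ⁻¹' Y.carrier ∧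
            Y.carrier ⊆ X.carrier := by
      intro A hA
      obtain ⟨_, ⟨a, F, hF, rfl⟩, hAU, hU⟩ :=
        isTopologicalBasis_basicU.exists_subset_of_mem_open hA ho
      rw [← preimage_basicV_ofBounded hF] at hAU hU
      exact ⟨_, ⟨_, _, ofBounded_le_principal hF, rfl⟩, hAU,
        (filterEquiv (S := S)).surjective.preimage_subset_preimage_iff.1 hU⟩
    choose! Y hY hAY hYX using h1
    obtain ⟨t, ht, hcov⟩ := hc.elim_nhds_subcover (fun A => filterToPrime ⁻¹' (Y A).carrier)
      fun A hA => by
        obtain ⟨s, u, hus, e⟩ := hY A hA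
        have ho := isOpen_preimage_basicV hus
        have hm := hAY A hA
        rw [e] at hm ⊢
        exact ho.mem_nhds hm
    refine ⟨Y '' t, t.finite_toSet.image Y, ?_, ?_, ?_⟩
    · rintro _ ⟨A, hA, rfl⟩
      exact hY A (ht A hA)
    · rintro _ ⟨A, hA, rfl⟩ _ ⟨B, hB, rfl⟩
      -- Compatibility is automatic: both sets lie in the partial bisection X.
      exact compatible_of_subset (hYX A (ht A hA)) (hYX B (ht B hB))
    · rw [Set.biUnion_image]
      refine Set.Subset.antisymm (fun P hP => ?_)
        (Set.iUnion₂_subset fun A hA => hYX A (ht A hA))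
      obtain ⟨A, rfl⟩ := filterEquiv.surjective P
      obtain ⟨B, hB, hAB⟩ := Set.mem_iUnion₂.1 (hcov (show A ∈ filterToPrime ⁻¹' X.carrier from hP))
      exact Set.mem_biUnion hB hAB
  · rintro ⟨F, hF, hV, -, hX⟩
    change IsCompact (filterToPrime ⁻¹' X.carrier) ∧ IsOpen (filterToPrime ⁻¹' X.carrier)
    rw [hX, Set.preimage_iUnion₂]
    refine ⟨hF.isCompact_biUnion fun Y hY => ?_, isOpen_biUnion fun Y hY => ?_⟩
    · obtain ⟨s, t, -, rfl⟩ := hV Y hY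
      exact isCompact_preimage_basicV s t
    · obtain ⟨s, t, hts, rfl⟩ := hV Y hY
      exact isOpen_preimage_basicV hts

variable (S) in
/-- The inverse semigroup of compact-open partial bisections of the universal groupoid. -/
def compactOpenBisections : InverseSubsemigroup (PartialBisection (UniversalGroupoid S)) where
  carrier := KB (UniversalGroupoid S)
  zero_mem := ⟨isCompact_empty, isOpen_empty⟩
  mul_mem {a b} ha hb := by
    obtain ⟨X, rfl⟩ := (PartialBisection.comap filterEquiv isFunctor_filterEquiv).surjective a
    obtain ⟨Y, rfl⟩ := (PartialBisection.comap filterEquiv isFunctor_filterEquiv).surjective b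
    -- Closure under products is carried over from the Booleanization along Φ, with no topological
    -- argument about products of compact sets.
    rw [← map_mul, comap_mem_KB_iff]
    exact (Booleanization S).mul_mem (comap_mem_KB_iff.1 ha) (comap_mem_KB_iff.1 hb)
  inv_mem {a} ha := by
    obtain ⟨X, rfl⟩ := (PartialBisection.comap filterEquiv isFunctor_filterEquiv).surjective a
    rw [← map_inv_of_mulEquiv, comap_mem_KB_iff]
    exact (Booleanization S).inv_mem (comap_mem_KB_iff.1 ha)

variable (S) in
/-- The isomorphism from the Booleanization given by pulling back along `Φ`. -/
def booleanizationEquiv : Booleanization S ≃* compactOpenBisections S where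
  toEquiv := (PartialBisection.comap filterEquiv isFunctor_filterEquiv).toEquiv.subtypeEquiv
    fun _ => comap_mem_KB_iff.symm
  map_mul' X Y := Subtype.ext
    (map_mul (PartialBisection.comap filterEquiv isFunctor_filterEquiv) X.1 Y.1)

theorem compactOpenBisections_le_iff {X Y : compactOpenBisections S} :
    naturalOrder.le X Y ↔ X.1.carrier ⊆ Y.1.carrier :=
  InverseSubsemigroup.le_iff.trans PartialBisection.le_iff_subset

theorem exists_union {X Y : compactOpenBisections S} (h : Compatible X Y) :
    ∃ Z : compactOpenBisections S, Z.1.carrier = X.1.carrier ∪ Y.1.carrier :=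
  ⟨⟨X.1.union Y.1 (InverseSubsemigroup.compatible_iff.1 h),
    X.2.1.union Y.2.1, X.2.2.union Y.2.2⟩, rfl⟩

theorem isLUB_of_union {X Y Z : compactOpenBisections S}
    (h : Z.1.carrier = X.1.carrier ∪ Y.1.carrier) : @IsLUB _ naturalOrder.toLE {X, Y} Z := by
  constructor
  · rintro W (rfl | rfl)
    · exact compactOpenBisections_le_iff.2 (h ▸ Set.subset_union_left)
    · exact compactOpenBisections_le_iff.2 (h ▸ Set.subset_union_right)
  · intro W hW
    refine compactOpenBisections_le_iff.2 ?_
    rw [h]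
    exact Set.union_subset (compactOpenBisections_le_iff.1 (hW (by simp)))
      (compactOpenBisections_le_iff.1 (hW (by simp)))

theorem union_of_isLUB {X Y Z : compactOpenBisections S} (hXY : Compatible X Y)
    (h : @IsLUB _ naturalOrder.toLE {X, Y} Z) : Z.1.carrier = X.1.carrier ∪ Y.1.carrier := by
  obtain ⟨W, hW⟩ := exists_union hXY
  rw [@IsLUB.unique _ naturalOrder _ _ _ h (isLUB_of_union hW), hW]

/-- Compatible joins are unions, and multiplication of subsets distributes over unions. -/
theorem isDistributive_compactOpenBisections : IsDistributive (compactOpenBisections S) where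
  exists_join X Y h := by
    obtain ⟨Z, hZ⟩ := exists_union h
    exact ⟨Z, isLUB_of_union hZ⟩
  mul_join X Y Z W hXY h := by
    apply isLUB_of_union
    have hZ := union_of_isLUB hXY h
    ext z
    constructor
    · rintro ⟨x, hx, y, hy, k, rfl⟩
      rw [hZ] at hy
      exact hy.imp (fun hy => ⟨x, hx, y, hy, k, rfl⟩) (fun hy => ⟨x, hx, y, hy, k, rfl⟩)
    · rintro (⟨x, hx, y, hy, k, rfl⟩ | ⟨x, hx, y, hy, k, rfl⟩)
      · exact ⟨x, hx, y, by rw [hZ]; exact Or.inl hy, k, rfl⟩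
      · exact ⟨x, hx, y, by rw [hZ]; exact Or.inr hy, k, rfl⟩
  join_mul X Y Z W hXY h := by
    apply isLUB_of_union
    have hZ := union_of_isLUB hXY h
    ext z
    constructor
    · rintro ⟨x, hx, y, hy, k, rfl⟩
      rw [hZ] at hx
      exact hx.imp (fun hx => ⟨x, hx, y, hy, k, rfl⟩) (fun hx => ⟨x, hx, y, hy, k, rfl⟩)
    · rintro (⟨x, hx, y, hy, k, rfl⟩ | ⟨x, hx, y, hy, k, rfl⟩)
      · exact ⟨x, by rw [hZ]; exact Or.inl hx, y, hy, k, rfl⟩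
      · exact ⟨x, by rw [hZ]; exact Or.inr hx, y, hy, k, rfl⟩

/-! ### The generalized Boolean algebra of idempotents -/

theorem identity_of_mem {E : {E : compactOpenBisections S // IsIdempotentElem E}}
    {x : UniversalGroupoid S} (hx : x ∈ E.1.1.carrier) : d x = x :=
  PartialBisection.isIdempotentElem_iff.1 (InverseSubsemigroup.isIdempotentElem_iff.1 E.2) x hx

/-- A compact-open set of identities, as an idempotent compact-open partial bisection. -/
def idempotentOfSet (U : Set (UniversalGroupoid S)) (hU : ∀ x ∈ U, d x = x)
    (hc : IsCompact U) (ho : IsOpen U) : {E : compactOpenBisections S // IsIdempotentElem E} :=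
  ⟨⟨⟨U, fun x hx y hy e => by rw [← hU x hx, e, hU y hy],
    fun x hx y hy e => by rw [← hU x hx, ← hU y hy, ← r_d x, ← r_d y, hU x hx, hU y hy, e]⟩,
      hc, ho⟩,
    InverseSubsemigroup.isIdempotentElem_iff.2 (PartialBisection.isIdempotentElem_iff.2 hU)⟩

/-- Compact sets are known to be closed only within the identities, where the Hausdorff property
holds. So F is closed there, and its complement is the trace of an open set O of the groupoid. As E
is open and consists of identities, the difference is E ∩ O. -/
theorem isOpen_sdiff (E F : {E : compactOpenBisections S // IsIdempotentElem E}) :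
    IsOpen (E.1.1.carrier \ F.1.1.carrier) := by
  have hF : IsCompact (Subtype.val ⁻¹' F.1.1.carrier : Set (Identities (UniversalGroupoid S))) := by
    refine Topology.IsInducing.subtypeVal.isCompact_iff.2 ?_
    have h : Subtype.val '' (Subtype.val ⁻¹' F.1.1.carrier : Set (Identities _)) = F.1.1.carrier :=
      Set.image_preimage_eq_of_subset fun x hx => ⟨⟨x, identity_of_mem hx⟩, rfl⟩
    exact (congrArg IsCompact h).mpr F.1.2.1
  obtain ⟨O, hO, hOF⟩ := isOpen_induced_iff.1 hF.isClosed.isOpen_compl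
  have h : E.1.1.carrier \ F.1.1.carrier = E.1.1.carrier ∩ O := by
    ext x
    refine and_congr_right fun hx => ?_
    exact (Set.ext_iff.1 hOF ⟨x, identity_of_mem hx⟩).symm
  rw [h]
  exact E.1.2.2.inter hO

/-- The intersection equals E minus the open set E \ F, and a compact set minus an open set is
compact. -/
theorem isCompact_inter (E F : {E : compactOpenBisections S // IsIdempotentElem E}) :
    IsCompact (E.1.1.carrier ∩ F.1.1.carrier) := by
  have h := E.1.2.1.diff (isOpen_sdiff E F)
  have e := Set.sdiff_sdiff_right_self E.1.1.carrier F.1.1.carrier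
  exact e ▸ h

/-- The generalized Boolean algebra of compact-open sets of identities. -/
abbrev idempotentsGeneralizedBooleanAlgebra :
    GeneralizedBooleanAlgebra {E : compactOpenBisections S // IsIdempotentElem E} :=
  letI : LE {E : compactOpenBisections S // IsIdempotentElem E} :=
    ⟨fun E F => E.1.1.carrier ⊆ F.1.1.carrier⟩
  letI : LT {E : compactOpenBisections S // IsIdempotentElem E} :=
    ⟨fun E F => E.1.1.carrier ⊂ F.1.1.carrier⟩
  letI : Max {E : compactOpenBisections S // IsIdempotentElem E} :=
    ⟨fun E F => idempotentOfSet (E.1.1.carrier ∪ F.1.1.carrier)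
      (fun _ hx => hx.elim identity_of_mem identity_of_mem)
      (E.1.2.1.union F.1.2.1) (E.1.2.2.union F.1.2.2)⟩
  letI : Min {E : compactOpenBisections S // IsIdempotentElem E} :=
    ⟨fun E F => idempotentOfSet (E.1.1.carrier ∩ F.1.1.carrier)
      (fun _ hx => identity_of_mem hx.1) (isCompact_inter E F) (E.1.2.2.inter F.1.2.2)⟩
  letI : Bot {E : compactOpenBisections S // IsIdempotentElem E} :=
    ⟨idempotentOfSet ∅ (fun _ hx => hx.elim) isCompact_empty isOpen_empty⟩
  letI : SDiff {E : compactOpenBisections S // IsIdempotentElem E} :=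
    ⟨fun E F => idempotentOfSet (E.1.1.carrier \ F.1.1.carrier)
      (fun _ hx => identity_of_mem hx.1) (E.1.2.1.diff F.1.2.2) (isOpen_sdiff E F)⟩
  -- The operations are those of the power set, so its laws pull back along the injective carrier
  -- map.
  Function.Injective.generalizedBooleanAlgebra
    (fun E : {E : compactOpenBisections S // IsIdempotentElem E} => E.1.1.carrier)
    (fun _ _ h => Subtype.ext (Subtype.ext (PartialBisection.ext h)))
    Iff.rfl Iff.rfl (fun _ _ => rfl) (fun _ _ => rfl) rfl (fun _ _ => rfl)

theorem isBoolean_compactOpenBisections : IsBoolean (compactOpenBisections S) :=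
  ⟨isDistributive_compactOpenBisections, idempotentsGeneralizedBooleanAlgebra,
    fun _ _ => compactOpenBisections_le_iff.symm⟩

end UniversalGroupoid

end InvSgp

/-! ### The main theorem -/

theorem mainTheorem2 {S : Type*} [InvSgp.InverseSemigroupWithZero S] :
    InvSgp.IsBooleanGroupoid (InvSgp.UniversalGroupoid S) ∧
    ∃ Φ : InvSgp.UniversalGroupoid S ≃ₜ InvSgp.PrimeFilter (InvSgp.DistributiveCompletion S),
      InvSgp.IsFunctor Φ ∧
      (∀ F, (Φ F : Set (InvSgp.DistributiveCompletion S)) =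
        {A : InvSgp.DistributiveCompletion S | ((A : Set S) ∩ (F : Set S)).Nonempty}) ∧
      ∃ K : InvSgp.InverseSubsemigroup (InvSgp.PartialBisection (InvSgp.UniversalGroupoid S)),
        (K : Set (InvSgp.PartialBisection (InvSgp.UniversalGroupoid S))) =
          InvSgp.KB (InvSgp.UniversalGroupoid S) ∧
        InvSgp.IsBoolean K ∧
        ∃ ψ : InvSgp.Booleanization S ≃* K,
          (∀ X, ((ψ X : InvSgp.PartialBisection (InvSgp.UniversalGroupoid S)) :
              Set (InvSgp.UniversalGroupoid S)) =
            Φ ⁻¹' ((X : InvSgp.PartialBisection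
              (InvSgp.PrimeFilter (InvSgp.DistributiveCompletion S))) : Set _)) ∧
          ∀ s : S, ((ψ (InvSgp.beta s) : InvSgp.PartialBisection (InvSgp.UniversalGroupoid S)) :
              Set (InvSgp.UniversalGroupoid S)) = {F | s ∈ F} := by
  refine ⟨InvSgp.UniversalGroupoid.isBooleanGroupoid,
    InvSgp.DistributiveCompletion.filterHomeomorph, InvSgp.isFunctor_filterEquiv,
    fun _ => rfl, InvSgp.UniversalGroupoid.compactOpenBisections S, rfl,
    InvSgp.UniversalGroupoid.isBoolean_compactOpenBisections,
    InvSgp.UniversalGroupoid.booleanizationEquiv S, fun _ => rfl, fun s => Set.ext fun F => ?_⟩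
  -- β(s) is V_{s↓;0}, and its second condition is vacuous because a prime filter omits 0.
  have h : (InvSgp.DistributiveCompletion.principal s ∈
      InvSgp.DistributiveCompletion.filterToPrime F ∧
      (0 : InvSgp.DistributiveCompletion S) ∉ InvSgp.DistributiveCompletion.filterToPrime F) ↔
      s ∈ F := by
    rw [InvSgp.DistributiveCompletion.principal_mem_filterToPrime]
    exact and_iff_left (InvSgp.DistributiveCompletion.filterToPrime F).zero_notMem
  exact h
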